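/- Let $(M^n,g)$ be a smooth Riemannian manifold of dimension $n$ (without boundary), with Levi-Civita connection $\nabla$ and Ricci tensor $Ric$. Let $\varphi, f, \lambda$ be smooth real functions on $M$ with $f>0$, and let $m$ be a positive integer, such that $M$ is a Ricci-Hessian type manifold, i.e. $$Ric+\nabla^2\varphi=\lambda g+\frac{m}{f}\nabla^2 f ,$$ where $\nabla^2u(X,Y)=g(\nabla_X\nabla u,Y)$ is the Hessian of a function $u$. With $\Delta\varphi$ the trace of $\nabla^2\varphi$ and $\alpha\wedge\beta=\alpha\otimes\beta-\beta\otimes\alpha$ for 1-forms, the following identities hold on $M$: 1. $f\,d\varphi\wedge d\lambda=df\wedge\Big[(n+m-2)\,d\lambda+\frac{m}{f}\,d\big(g(\nabla\varphi,\nabla f)\big)-d|\nabla\varphi|^2+2\lambda\,d\varphi+d\Delta\varphi\Big]$; 2. $df\wedge d\varphi\wedge d\lambda=0$. -/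

import Mathlib

open Bundle FiberBundle VectorField
open scoped Manifold ContDiff

/-! Riemannian geometry of a smooth manifold `M` (without boundary, modelled on a finite-dimensional
real vector space `E`).  The Riemannian metric is Mathlib's: an inner product on every tangent
space (`RiemannianBundle`) depending smoothly on the point (`IsContMDiffRiemannianBundle`). -/

set_option linter.unusedSectionVars false

noncomputable section

namespace RicciHessian

variable {E : Type*} [NormedAddCommGroup E] [NormedSpace ℝ E] [FiniteDimensional ℝ E]
  {M : Type*} [TopologicalSpace M] [ChartedSpace E M] [IsManifold 𝓘(ℝ, E) ∞ M]
  [RiemannianBundle (fun x : M ↦ TangentSpace 𝓘(ℝ, E) x)]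
  [IsContMDiffRiemannianBundle 𝓘(ℝ, E) ∞ E (fun x : M ↦ TangentSpace 𝓘(ℝ, E) x)]

instance finiteDimensional_tangentSpace (x : M) :
    FiniteDimensional ℝ (TangentSpace 𝓘(ℝ, E) x) :=
  inferInstanceAs (FiniteDimensional ℝ E)

instance completeSpace_tangentSpace (x : M) : CompleteSpace (TangentSpace 𝓘(ℝ, E) x) :=
  FiniteDimensional.complete ℝ _

/-- The pointwise inner product `g(X, Y)` of two vector fields, as a function on `M`. -/
def innerField (X Y : Π x : M, TangentSpace 𝓘(ℝ, E) x) (x : M) : ℝ := inner ℝ (X x) (Y x)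

/-- The right-hand side of the Koszul formula:
`g(∇_X Y, Z) = ½ (X g(Y,Z) + Y g(Z,X) - Z g(X,Y) + g([X,Y],Z) - g([Y,Z],X) + g([Z,X],Y))`. -/
def koszul (x : M) (Y X Z : Π x : M, TangentSpace 𝓘(ℝ, E) x) : ℝ :=
  (1 / 2) * (d% (innerField Y Z) x (X x) + d% (innerField Z X) x (Y x)
    - d% (innerField X Y) x (Z x)
    + inner ℝ (mlieBracket 𝓘(ℝ, E) X Y x) (Z x)
    - inner ℝ (mlieBracket 𝓘(ℝ, E) Y Z x) (X x)
    + inner ℝ (mlieBracket 𝓘(ℝ, E) Z X x) (Y x))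

variable {X X' Y Y' Z Z' : Π x : M, TangentSpace 𝓘(ℝ, E) x} {f : M → ℝ} {x : M}

theorem innerField_comm : innerField X Y = innerField Y X := by
  ext x; exact real_inner_comm _ _

theorem mdiffAt_innerField (hX : MDiffAt (T% X) x) (hY : MDiffAt (T% Y) x) :
    MDiffAt (innerField X Y) x :=
  MDifferentiableAt.inner_bundle hX hY

theorem mvfderiv_innerField_add (hX : MDiffAt (T% X) x) (hX' : MDiffAt (T% X') x)
    (hY : MDiffAt (T% Y) x) :
    d% (innerField (X + X') Y) x = d% (innerField X Y) x + d% (innerField X' Y) x := by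
  have : innerField (X + X') Y = innerField X Y + innerField X' Y := by
    ext y; simp [innerField, inner_add_left]
  rw [this, mvfderiv_add (mdiffAt_innerField hX hY) (mdiffAt_innerField hX' hY)]

theorem mvfderiv_innerField_smul (hf : MDiffAt f x) (hX : MDiffAt (T% X) x)
    (hY : MDiffAt (T% Y) x) :
    d% (innerField (f • X) Y) x
      = f x • d% (innerField X Y) x + innerField X Y x • d% f x := by
  have : innerField (f • X) Y = f * innerField X Y := by
    ext y; simp [innerField, inner_smul_left]
  rw [this, mvfderiv_mul hf (mdiffAt_innerField hX hY)]

theorem koszul_tensorial_left (hY : MDiffAt (T% Y) x) (hZ : MDiffAt (T% Z) x) :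
    TensorialAt 𝓘(ℝ, E) E (fun X ↦ koszul x Y X Z) x where
  smul {f X} hf hX := by
    simp only [koszul]
    rw [innerField_comm (X := Z), mvfderiv_innerField_smul hf hX hZ,
      mvfderiv_innerField_smul hf hX hY, mlieBracket_smul_left hf hX, mlieBracket_smul_right hf hX,
      innerField_comm (X := Z) (Y := X)]
    simp [innerField, inner_add_left, inner_smul_left, inner_smul_right, real_inner_comm]
    ring
  add {X X'} hX hX' := by
    simp only [koszul]
    rw [innerField_comm (X := Z), mvfderiv_innerField_add hX hX' hZ,
      mvfderiv_innerField_add hX hX' hY, mlieBracket_add_left hX hX', mlieBracket_add_right hX hX',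
      innerField_comm (X := Z) (Y := X), innerField_comm (X := Z) (Y := X')]
    simp [inner_add_left, inner_add_right]
    ring

theorem koszul_tensorial_right (hY : MDiffAt (T% Y) x) (hX : MDiffAt (T% X) x) :
    TensorialAt 𝓘(ℝ, E) E (fun Z ↦ koszul x Y X Z) x where
  smul {f Z} hf hZ := by
    simp only [koszul]
    rw [innerField_comm (X := Y), mvfderiv_innerField_smul hf hZ hX,
      mvfderiv_innerField_smul hf hZ hY, mlieBracket_smul_left hf hZ, mlieBracket_smul_right hf hZ,
      innerField_comm (X := Y) (Y := Z)]
    simp [innerField, inner_add_left, inner_smul_left, inner_smul_right, real_inner_comm]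
    ring
  add {Z Z'} hZ hZ' := by
    simp only [koszul]
    rw [innerField_comm (X := Y), mvfderiv_innerField_add hZ hZ' hX,
      mvfderiv_innerField_add hZ hZ' hY, mlieBracket_add_left hZ hZ', mlieBracket_add_right hZ hZ',
      innerField_comm (X := Y) (Y := Z), innerField_comm (X := Y) (Y := Z')]
    simp [inner_add_left, inner_add_right]
    ring

theorem mdiffAt_extend (v : TangentSpace 𝓘(ℝ, E) x) :
    MDiffAt (T% (extend E v : Π y : M, TangentSpace 𝓘(ℝ, E) y)) x :=
  mdifferentiableAt_extend ..

theorem koszul_add (hY : MDiffAt (T% Y) x) (hY' : MDiffAt (T% Y') x)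
    (hX : MDiffAt (T% X) x) (hZ : MDiffAt (T% Z) x) :
    koszul x (Y + Y') X Z = koszul x Y X Z + koszul x Y' X Z := by
  simp only [koszul]
  rw [innerField_comm (X := X), mvfderiv_innerField_add hY hY' hZ,
    mvfderiv_innerField_add hY hY' hX, mlieBracket_add_left hY hY', mlieBracket_add_right hY hY',
    innerField_comm (X := X) (Y := Y), innerField_comm (X := X) (Y := Y')]
  simp [inner_add_left, inner_add_right]
  ring

theorem koszul_smul (hf : MDiffAt f x) (hY : MDiffAt (T% Y) x)
    (hX : MDiffAt (T% X) x) (hZ : MDiffAt (T% Z) x) :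
    koszul x (f • Y) X Z = f x * koszul x Y X Z + d% f x (X x) * inner ℝ (Y x) (Z x) := by
  simp only [koszul]
  rw [innerField_comm (X := X), mvfderiv_innerField_smul hf hY hZ,
    mvfderiv_innerField_smul hf hY hX, mlieBracket_smul_left hf hY, mlieBracket_smul_right hf hY,
    innerField_comm (X := X) (Y := Y)]
  simp [innerField, inner_add_left, inner_smul_left, inner_smul_right, real_inner_comm]
  ring

/-- The bilinear form `(v, w) ↦ g(∇_v Y, w)` on `T_x M`, for `Y` differentiable at `x`. -/
def leviCivitaForm (hY : MDiffAt (T% Y) x) :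
    TangentSpace 𝓘(ℝ, E) x →L[ℝ] TangentSpace 𝓘(ℝ, E) x →L[ℝ] ℝ :=
  TensorialAt.mkHom₂ (koszul x Y) x (fun _ hZ ↦ koszul_tensorial_left hY hZ)
    (fun _ hX ↦ koszul_tensorial_right hY hX)

theorem leviCivitaForm_apply (hY : MDiffAt (T% Y) x) (hX : MDiffAt (T% X) x)
    (hZ : MDiffAt (T% Z) x) : leviCivitaForm hY (X x) (Z x) = koszul x Y X Z :=
  TensorialAt.mkHom₂_apply _ _ hX hZ

open Classical in
/-- `v ↦ ∇_v Y` at `x`: the endomorphism of `T_x M` that the metric associates with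
`leviCivitaForm`, and `0` if `Y` is not differentiable at `x`. -/
def leviCivitaFun (Y : Π x : M, TangentSpace 𝓘(ℝ, E) x) (x : M) :
    TangentSpace 𝓘(ℝ, E) x →L[ℝ] TangentSpace 𝓘(ℝ, E) x :=
  if hY : MDiffAt (T% Y) x then
    LinearMap.toContinuousLinearMap
      { toFun := fun v ↦ (InnerProductSpace.toDual ℝ (TangentSpace 𝓘(ℝ, E) x)).symm
          (leviCivitaForm hY v)
        map_add' := fun v w ↦ by simp
        map_smul' := fun c v ↦ by simp }
  else 0

theorem inner_leviCivitaFun (hY : MDiffAt (T% Y) x) (hX : MDiffAt (T% X) x)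
    (hZ : MDiffAt (T% Z) x) :
    inner ℝ (leviCivitaFun Y x (X x)) (Z x) = koszul x Y X Z := by
  rw [← leviCivitaForm_apply hY hX hZ, leviCivitaFun, dif_pos hY]
  exact InnerProductSpace.toDual_symm_apply

theorem leviCivitaFun_ext {A B : TangentSpace 𝓘(ℝ, E) x →L[ℝ] TangentSpace 𝓘(ℝ, E) x}
    (h : ∀ v w, inner ℝ (A v) w = inner ℝ (B v) w) : A = B := by
  ext v
  exact ext_inner_right ℝ (h v)

theorem inner_leviCivitaFun_extend (hY : MDiffAt (T% Y) x) (v w : TangentSpace 𝓘(ℝ, E) x) :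
    inner ℝ (leviCivitaFun Y x v) w = koszul x Y (extend E v) (extend E w) := by
  simpa using inner_leviCivitaFun hY (mdiffAt_extend v) (mdiffAt_extend w)

/-- The Levi-Civita connection `∇` of the Riemannian metric; `leviCivita Y x v` is `(∇_v Y)(x)`. -/
def leviCivita : CovariantDerivative 𝓘(ℝ, E) E (fun x : M ↦ TangentSpace 𝓘(ℝ, E) x) where
  toFun := leviCivitaFun
  isCovariantDerivativeOnUniv :=
    { add := fun {Y Y' x} hY hY' _ ↦ by
        refine leviCivitaFun_ext fun v w ↦ ?_
        rw [inner_leviCivitaFun_extend (mdifferentiableAt_add_section hY hY'),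
          koszul_add hY hY' (mdiffAt_extend v) (mdiffAt_extend w)]
        simp [inner_add_left, inner_leviCivitaFun_extend hY, inner_leviCivitaFun_extend hY']
      leibniz := fun {Y f x} hY hf _ ↦ by
        refine leviCivitaFun_ext fun v w ↦ ?_
        rw [inner_leviCivitaFun_extend (hf.smul_section hY),
          koszul_smul hf hY (mdiffAt_extend v) (mdiffAt_extend w)]
        simp [inner_add_left, inner_smul_left, inner_leviCivitaFun_extend hY] }

theorem inner_leviCivita (hY : MDiffAt (T% Y) x) (hX : MDiffAt (T% X) x)
    (hZ : MDiffAt (T% Z) x) :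
    inner ℝ (leviCivita Y x (X x)) (Z x) = koszul x Y X Z :=
  inner_leviCivitaFun hY hX hZ

theorem torsion_leviCivita :
    (leviCivita : CovariantDerivative 𝓘(ℝ, E) E
      (fun x : M ↦ TangentSpace 𝓘(ℝ, E) x)).torsion = 0 := by
  rw [CovariantDerivative.torsion_eq_zero_iff]
  intro X Y x hX hY
  refine ext_inner_right ℝ fun w ↦ ?_
  have hZ := mdiffAt_extend w
  have h1 := inner_leviCivita hY hX hZ
  have h2 := inner_leviCivita hX hY hZ
  rw [extend_apply_self] at h1 h2
  rw [inner_sub_left, h1, h2]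
  simp only [koszul]
  rw [mlieBracket_swap_apply (V := Y) (W := X), mlieBracket_swap_apply (V := extend E w) (W := Y),
    mlieBracket_swap_apply (V := extend E w) (W := X), innerField_comm (X := extend E w) (Y := X),
    innerField_comm (X := extend E w) (Y := Y), innerField_comm (X := Y) (Y := X)]
  simp
  ring

theorem mvfderiv_innerField (hX : MDiffAt (T% X) x) (hY : MDiffAt (T% Y) x)
    (hZ : MDiffAt (T% Z) x) :
    d% (innerField Y Z) x (X x)
      = inner ℝ (leviCivita Y x (X x)) (Z x) + inner ℝ (Y x) (leviCivita Z x (X x)) := by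
  have h1 := inner_leviCivita hY hX hZ
  have h2 := inner_leviCivita hZ hX hY
  rw [real_inner_comm] at h2
  rw [h1, h2]
  simp only [koszul]
  rw [mlieBracket_swap_apply (V := Y) (W := X), mlieBracket_swap_apply (V := Z) (W := X),
    mlieBracket_swap_apply (V := Z) (W := Y),
    innerField_comm (X := Z) (Y := X),
    innerField_comm (X := Z) (Y := Y), innerField_comm (X := Y) (Y := X)]
  simp
  ring

/-- The gradient `∇u`: `g(∇u, v) = du(v)`. -/
def grad (u : M → ℝ) (x : M) : TangentSpace 𝓘(ℝ, E) x :=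
  (InnerProductSpace.toDual ℝ (TangentSpace 𝓘(ℝ, E) x)).symm (d% u x)

variable (E) in
/-- The function `g(∇u, ∇v)`; in particular `gradInner E u u = |∇u|²`. -/
def gradInner (u v : M → ℝ) (x : M) : ℝ :=
  inner ℝ (grad u x : TangentSpace 𝓘(ℝ, E) x) (grad v x)

/-- The Hessian `∇²u(v, w) = g(∇_v ∇u, w)`. -/
def hess (u : M → ℝ) (x : M) (v w : TangentSpace 𝓘(ℝ, E) x) : ℝ :=
  inner ℝ (leviCivita (grad u) x v) w

variable (E) in
/-- The Laplacian `Δu`, the trace of the Hessian, i.e. of `v ↦ ∇_v ∇u`. -/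
def laplacian (u : M → ℝ) (x : M) : ℝ :=
  LinearMap.trace ℝ (TangentSpace 𝓘(ℝ, E) x) (leviCivita (grad u) x).toLinearMap

/-- The Riemann curvature `Rm(X, Y) Z = ∇_X ∇_Y Z - ∇_Y ∇_X Z - ∇_[X, Y] Z` of vector fields. -/
def riemann (X Y Z : Π x : M, TangentSpace 𝓘(ℝ, E) x) (x : M) : TangentSpace 𝓘(ℝ, E) x :=
  leviCivita (fun y ↦ leviCivita Z y (Y y)) x (X x)
    - leviCivita (fun y ↦ leviCivita Z y (X y)) x (Y x)
    - leviCivita Z x (mlieBracket 𝓘(ℝ, E) X Y x)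

/-- The Ricci tensor `Ric(v, w) = ∑ i, g(Rm(e i, v) w, e i)`, for an orthonormal basis `e` of
`T_x M`, where tangent vectors at `x` are extended to vector fields that are smooth near `x`
(`Rm` being tensorial, the choice of the extensions does not matter). -/
def ricci (x : M) (v w : TangentSpace 𝓘(ℝ, E) x) : ℝ :=
  ∑ i, inner ℝ
    (riemann (extend E (stdOrthonormalBasis ℝ (TangentSpace 𝓘(ℝ, E) x) i)) (extend E v)
      (extend E w) x)
    (stdOrthonormalBasis ℝ (TangentSpace 𝓘(ℝ, E) x) i)

variable (E) in
/-- `M` with its Riemannian metric is a Ricci-Hessian type manifold with potential function `φ`,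
warping function `f`, and functions `lam`, `m`. -/
structure IsRicciHessianType (m : ℕ) (φ f lam : M → ℝ) : Prop where
  smooth_potential : CMDiff ∞ φ
  smooth_warping : CMDiff ∞ f
  smooth_lam : CMDiff ∞ lam
  m_pos : 0 < m
  warping_pos : ∀ x, 0 < f x
  equation : ∀ (x : M) (v w : TangentSpace 𝓘(ℝ, E) x),
    ricci x v w + hess φ x v w = lam x * inner ℝ v w + (m / f x) * hess f x v w

/-- The wedge product `α 0 ∧ ⋯ ∧ α (k - 1)` of `k` linear forms (determinant convention), the
alternating form `(v 0, …, v (k - 1)) ↦ det (α j (v i))`; so `α ∧ β = α ⊗ β - β ⊗ α`. -/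
def wedge {V : Type*} [AddCommGroup V] [Module ℝ V] {k : ℕ} (α : Fin k → (V →ₗ[ℝ] ℝ)) :
    V [⋀^Fin k]→ₗ[ℝ] ℝ :=
  Matrix.detRowAlternating.compLinearMap (LinearMap.pi α)

end RicciHessian

end

open RicciHessian

/-!
The functions `φ`, `f`, `λ` enter through a single identity of one-forms, obtained by taking twice
the divergence of `Ric + ∇²φ = λ g + (m / f) ∇²f` and subtracting the differential of its trace.
Two contracted identities turn both sides into differentials of functions: the contracted Bianchi
identity `2 div Ric = dR` and the contracted Ricci identity `div ∇²u = dΔu + Ric(∇u, ·)`; the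
terms `Ric(∇φ, ·)` and `Ric(∇f, ·)` are eliminated with the equation itself, and
`∇²u(·, ∇w) + ∇²w(·, ∇u) = d g(∇u, ∇w)`.  After multiplication by `f²` this reads
(`IsRicciHessianType.divergence_identity`)

`f² ((n - 2) dλ + dΔφ + 2 λ dφ - d|∇φ|²) + 2 m f dg(∇φ, ∇f)
  = m (f dΔf + (Δf + 2 f λ) df + (m - 1) d|∇f|²)`.

Both sides are sums of terms `a db`, so `d² = 0` gives `∑ da ∧ db = 0`
(`sum_wedge_eq_zero_of_sum_smul_eq_zero`).  The terms with `Δf` and `|∇f|²` cancel, and division by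
`2 f` leaves the first identity.  Its wedge product with `df` is the second one, up to the
factor `f > 0`.

The contracted identities (`IsNormalFrameAt.contracted_bianchi`, `IsNormalFrameAt.divergence_hess`)
are proved at a point `x` with vector fields that are orthonormal and have vanishing covariant
derivative at `x`.  For such fields the second Bianchi identity follows from the tensoriality of
the curvature, and `d (tr A) = tr (∇A)` (`SmoothEndNear.mvfderiv_trace`) differentiates the traces
`Δu` and `Ric`, although the frame need not be orthonormal away from `x`.  In the double trace of
the second Bianchi identity only the antisymmetry of `g(Rm(X, Y) Z, W)` in `X, Y` and in `Z, W` is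
used.
-/

noncomputable section

namespace RicciHessian

open Filter Topology Module

variable {E : Type*} [NormedAddCommGroup E] [NormedSpace ℝ E] [FiniteDimensional ℝ E]
  {M : Type*} [TopologicalSpace M] [ChartedSpace E M] [IsManifold 𝓘(ℝ, E) ∞ M]
  {X X' Y Y' Z Z' W V : Π x : M, TangentSpace 𝓘(ℝ, E) x} {u w : M → ℝ} {x : M}

/-! ### Functions and vector fields that are smooth near a point -/

/-- The vector field `X` is smooth on a neighbourhood of `x`.  This is stronger than being
`C^∞` at `x`, which only provides for each `k` a neighbourhood of `x` where `X` is `C^k`. -/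
def SmoothNear (X : Π x : M, TangentSpace 𝓘(ℝ, E) x) (x : M) : Prop :=
  ∀ᶠ y in 𝓝 x, CMDiffAt ∞ (T% X) y

variable (E) in
/-- The function `u` is smooth on a neighbourhood of `x`. -/
def SmoothFunNear (u : M → ℝ) (x : M) : Prop :=
  ∀ᶠ y in 𝓝 x, ContMDiffAt 𝓘(ℝ, E) 𝓘(ℝ, ℝ) ∞ u y

namespace SmoothNear

theorem contMDiffAt (hX : SmoothNear X x) : CMDiffAt ∞ (T% X) x := hX.self_of_nhds

theorem mdiffAt (hX : SmoothNear X x) : MDiffAt (T% X) x :=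
  hX.contMDiffAt.mdifferentiableAt (by simp)

theorem eventually (hX : SmoothNear X x) : ∀ᶠ y in 𝓝 x, SmoothNear X y :=
  eventually_eventually_nhds.2 hX

theorem congr (hX : SmoothNear X x) (h : ∀ᶠ y in 𝓝 x, Y y = X y) : SmoothNear Y x := by
  filter_upwards [hX, h.eventually_nhds] with y hy h'
  exact hy.congr_of_eventuallyEq (h'.mono fun z hz ↦ by simp [hz])

end SmoothNear

theorem SmoothFunNear.contMDiffAt (hu : SmoothFunNear E u x) :
    ContMDiffAt 𝓘(ℝ, E) 𝓘(ℝ, ℝ) ∞ u x := hu.self_of_nhds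

theorem SmoothFunNear.mdiffAt (hu : SmoothFunNear E u x) :
    MDifferentiableAt 𝓘(ℝ, E) 𝓘(ℝ, ℝ) u x :=
  hu.contMDiffAt.mdifferentiableAt (by simp)

theorem SmoothFunNear.eventually (hu : SmoothFunNear E u x) : ∀ᶠ y in 𝓝 x, SmoothFunNear E u y :=
  eventually_eventually_nhds.2 hu

theorem SmoothFunNear.congr (hu : SmoothFunNear E u x) (h : ∀ᶠ y in 𝓝 x, w y = u y) :
    SmoothFunNear E w x := by
  filter_upwards [hu, h.eventually_nhds] with y hy h'
  exact hy.congr_of_eventuallyEq h'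

theorem smoothFunNear_of_contMDiff (hu : CMDiff ∞ u) : SmoothFunNear E u x :=
  Eventually.of_forall fun y ↦ hu y

theorem smoothFunNear_const (c : ℝ) : SmoothFunNear E (fun _ : M ↦ c) x :=
  Eventually.of_forall fun _ ↦ contMDiffAt_const

theorem SmoothFunNear.add (hu : SmoothFunNear E u x) (hw : SmoothFunNear E w x) :
    SmoothFunNear E (u + w) x := by
  filter_upwards [hu, hw] with y h1 h2 using h1.add h2

theorem SmoothFunNear.sub (hu : SmoothFunNear E u x) (hw : SmoothFunNear E w x) :
    SmoothFunNear E (u - w) x := by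
  filter_upwards [hu, hw] with y h1 h2 using h1.sub h2

theorem SmoothFunNear.mul (hu : SmoothFunNear E u x) (hw : SmoothFunNear E w x) :
    SmoothFunNear E (u * w) x := by
  filter_upwards [hu, hw] with y h1 h2 using h1.mul h2

theorem SmoothFunNear.sum {ι : Type*} {s : Finset ι} {a : ι → M → ℝ}
    (ha : ∀ i, SmoothFunNear E (a i) x) : SmoothFunNear E (fun y ↦ ∑ i ∈ s, a i y) x := by
  filter_upwards [(s.eventually_all (l := 𝓝 x)).2 fun i _ ↦ ha i] with y hy
  exact contMDiffAt_finsetSum hy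

theorem SmoothFunNear.prod {ι : Type*} [Fintype ι] {a : ι → M → ℝ}
    (ha : ∀ i, SmoothFunNear E (a i) x) : SmoothFunNear E (fun y ↦ ∏ i, a i y) x := by
  filter_upwards [eventually_all.2 ha] with y hy
  exact contMDiffAt_finsetProd fun i _ ↦ hy i

theorem SmoothFunNear.inv (hu : SmoothFunNear E u x) (h0 : u x ≠ 0) :
    SmoothFunNear E (fun y ↦ (u y)⁻¹) x := by
  filter_upwards [hu, hu.contMDiffAt.continuousAt.eventually_ne h0] with y h1 h2
  exact h1.inv₀ h2

theorem SmoothFunNear.det {ι : Type*} [Fintype ι] [DecidableEq ι] {A : M → Matrix ι ι ℝ}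
    (hA : ∀ i j, SmoothFunNear E (fun y ↦ A y i j) x) :
    SmoothFunNear E (fun y ↦ (A y).det) x := by
  simp only [Matrix.det_apply']
  exact .sum fun σ ↦ (smoothFunNear_const _).mul (.prod fun i ↦ hA _ _)

namespace SmoothNear

theorem zero : SmoothNear (0 : Π x : M, TangentSpace 𝓘(ℝ, E) x) x :=
  Eventually.of_forall fun y ↦ contMDiff_zeroSection _ _ y

theorem add (hX : SmoothNear X x) (hY : SmoothNear Y x) : SmoothNear (X + Y) x := by
  filter_upwards [hX, hY] with y h1 h2 using h1.add_section h2

theorem sub (hX : SmoothNear X x) (hY : SmoothNear Y x) : SmoothNear (X - Y) x := by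
  filter_upwards [hX, hY] with y h1 h2 using h1.sub_section h2

theorem smul (hu : SmoothFunNear E u x) (hX : SmoothNear X x) : SmoothNear (u • X) x := by
  filter_upwards [hu, hX] with y h1 h2 using h1.smul_section h2

theorem sum {ι : Type*} {X : ι → Π x : M, TangentSpace 𝓘(ℝ, E) x} {s : Finset ι}
    (hX : ∀ i, SmoothNear (X i) x) : SmoothNear (fun y ↦ ∑ i ∈ s, X i y) x := by
  filter_upwards [(s.eventually_all (l := 𝓝 x)).2 fun i _ ↦ hX i] with y hy
  exact .sum_section hy

theorem mlieBracket (hX : SmoothNear X x) (hY : SmoothNear Y x) :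
    SmoothNear (mlieBracket 𝓘(ℝ, E) X Y) x := by
  have : IsManifold 𝓘(ℝ, E) (((⊤ : ℕ∞) : ℕ∞ω) + 1) M := by
    have : (((⊤ : ℕ∞) : ℕ∞ω) + 1) = ∞ := rfl
    rw [this]; infer_instance
  have : IsManifold 𝓘(ℝ, E) (minSmoothness ℝ 2) M := by
    rw [minSmoothness_of_isRCLikeNormedField]; infer_instance
  filter_upwards [hX, hY] with y h1 h2
  exact ContMDiffAt.mlieBracket_vectorField (m := (⊤ : ℕ∞)) (n := (⊤ : ℕ∞)) h1 h2 (by simp)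

end SmoothNear

/-! ### Local frames of the tangent bundle -/

/-- The local frame of the tangent bundle that the trivialization at `x` induces. -/
def frameAt (x : M) (i : Fin (finrank ℝ E)) : Π y : M, TangentSpace 𝓘(ℝ, E) y :=
  (trivializationAt E (TangentSpace 𝓘(ℝ, E) : M → Type _) x).localFrame (finBasis ℝ E) i

/-- The coefficients of tangent vectors in the frame `frameAt x`. -/
def frameCoeff (x : M) (i : Fin (finrank ℝ E)) (y : M) : TangentSpace 𝓘(ℝ, E) y →ₗ[ℝ] ℝ :=
  (trivializationAt E (TangentSpace 𝓘(ℝ, E) : M → Type _) x).localFrameCoeff 𝓘(ℝ, E)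
    (finBasis ℝ E) i y

theorem eventually_mem_baseSet (x : M) :
    ∀ᶠ y in 𝓝 x, y ∈ (trivializationAt E (TangentSpace 𝓘(ℝ, E) : M → Type _) x).baseSet :=
  (trivializationAt E (TangentSpace 𝓘(ℝ, E) : M → Type _) x).open_baseSet.mem_nhds
    (FiberBundle.mem_baseSet_trivializationAt' x)

theorem smoothNear_frameAt (i : Fin (finrank ℝ E)) : SmoothNear (frameAt (E := E) x i) x := by
  filter_upwards [eventually_mem_baseSet (E := E) x] with y hy
  exact contMDiffAt_localFrame_of_mem ∞ _ _ i hy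

theorem smoothFunNear_frameCoeff (hX : SmoothNear X x) (i : Fin (finrank ℝ E)) :
    SmoothFunNear E (fun y ↦ frameCoeff x i y (X y)) x := by
  filter_upwards [eventually_mem_baseSet (E := E) x, hX] with y hy h
  exact contMDiffAt_localFrameCoeff (finBasis ℝ E) hy h i

theorem smoothNear_extend (v : TangentSpace 𝓘(ℝ, E) x) :
    SmoothNear (extend E v : Π y : M, TangentSpace 𝓘(ℝ, E) y) x := by
  filter_upwards [eventually_mem_baseSet (E := E) x] with y hy
  rw [Trivialization.contMDiffAt_section_iff _ hy]
  refine (contMDiffAt_const (c := (trivializationAt E (TangentSpace 𝓘(ℝ, E) : M → Type _) x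
    ⟨x, v⟩).2)).congr_of_eventuallyEq ?_
  filter_upwards [(trivializationAt E (TangentSpace 𝓘(ℝ, E) : M → Type _) x).open_baseSet.mem_nhds
    hy] with z hz
  simp only [extend]
  rw [Trivialization.apply_mk_symm _ hz]

/-- The basis of `T_y M` that the frame `frameAt x` induces. -/
def frameBasis {x y : M}
    (hy : y ∈ (trivializationAt E (TangentSpace 𝓘(ℝ, E) : M → Type _) x).baseSet) :
    Basis (Fin (finrank ℝ E)) ℝ (TangentSpace 𝓘(ℝ, E) y) :=
  (trivializationAt E (TangentSpace 𝓘(ℝ, E) : M → Type _) x).basisAt (finBasis ℝ E) hy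

theorem frameBasis_apply {x y : M}
    (hy : y ∈ (trivializationAt E (TangentSpace 𝓘(ℝ, E) : M → Type _) x).baseSet)
    (i : Fin (finrank ℝ E)) : frameBasis hy i = frameAt x i y :=
  (Trivialization.localFrame_apply_of_mem_baseSet _ _ hy).symm

theorem frameCoeff_apply {x y : M}
    (hy : y ∈ (trivializationAt E (TangentSpace 𝓘(ℝ, E) : M → Type _) x).baseSet)
    (i : Fin (finrank ℝ E)) (v : TangentSpace 𝓘(ℝ, E) y) :
    frameCoeff x i y v = (frameBasis hy).repr v i := by
  have := Trivialization.localFrameCoeff_apply_of_mem_baseSet (I := 𝓘(ℝ, E))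
    (trivializationAt E (TangentSpace 𝓘(ℝ, E) : M → Type _) x) (finBasis ℝ E) hy (extend E v) i
  rwa [extend_apply_self] at this

theorem sum_frameCoeff_smul {x y : M}
    (hy : y ∈ (trivializationAt E (TangentSpace 𝓘(ℝ, E) : M → Type _) x).baseSet)
    (v : TangentSpace 𝓘(ℝ, E) y) : v = ∑ i, frameCoeff x i y v • frameAt x i y := by
  simp only [frameCoeff_apply hy, ← frameBasis_apply hy]
  exact ((frameBasis hy).sum_repr v).symm

/-- The derivative of a smooth function along a smooth vector field is smooth: it is a coefficient,
in a local frame, of `[X, u Z] - u [X, Z] = (X u) Z` for a member `Z` of the frame. -/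
theorem SmoothFunNear.mvfderiv_apply (hu : SmoothFunNear E u x) (hX : SmoothNear X x) :
    SmoothFunNear E (fun y ↦ d% u y (X y)) x := by
  rcases isEmpty_or_nonempty (Fin (finrank ℝ E)) with hE | ⟨⟨i⟩⟩
  · have : Subsingleton E := (finBasis ℝ E).repr.toEquiv.subsingleton
    refine (smoothFunNear_const 0).congr (Eventually.of_forall fun y ↦ ?_)
    have : X y = 0 := Subsingleton.elim (α := E) _ _
    simp [this]
  have hZ := smoothNear_frameAt (E := E) (x := x) i
  refine (smoothFunNear_frameCoeff ((hX.mlieBracket (.smul hu hZ)).sub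
    (.smul hu (hX.mlieBracket hZ))) i).congr ?_
  filter_upwards [hu.eventually, hZ.eventually, eventually_mem_baseSet (E := E) x] with y hy hZy hyt
  have h2 : (VectorField.mlieBracket 𝓘(ℝ, E) X (u • frameAt x i)
      - u • VectorField.mlieBracket 𝓘(ℝ, E) X (frameAt x i)) y
      = d% u y (X y) • frameAt x i y := by
    simp [mlieBracket_smul_right hy.mdiffAt hZy.mdiffAt]
  rw [h2, map_smul, frameCoeff_apply hyt, ← frameBasis_apply hyt]
  simp

theorem mvfderiv_congr (h : ∀ᶠ y in 𝓝 x, u y = w y) :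
    mvfderiv 𝓘(ℝ, E) u x = mvfderiv 𝓘(ℝ, E) w x := by
  have h1 : mfderiv 𝓘(ℝ, E) 𝓘(ℝ, ℝ) u x = mfderiv 𝓘(ℝ, E) 𝓘(ℝ, ℝ) w x :=
    Filter.EventuallyEq.mfderiv_eq h
  ext v
  exact DFunLike.congr_fun h1 v

theorem mvfderiv_sum {ι : Type*} {s : Finset ι} {a : ι → M → ℝ}
    (ha : ∀ i, SmoothFunNear E (a i) x) :
    mvfderiv 𝓘(ℝ, E) (fun y ↦ ∑ i ∈ s, a i y) x = ∑ i ∈ s, mvfderiv 𝓘(ℝ, E) (a i) x := by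
  classical
  induction s using Finset.induction_on with
  | empty =>
    simp only [Finset.sum_empty]
    exact mvfderiv_const 0
  | insert j s hj h =>
    simp only [Finset.sum_insert hj, ← h]
    exact mvfderiv_add (ha j).mdiffAt (SmoothFunNear.sum ha).mdiffAt

/-! ### Tensorial operations on smooth vector fields -/

/-- An additive operation on germs of smooth vector fields at `x` that is linear over germs of
smooth functions.  Compared with Mathlib's `TensorialAt`, only smooth fields and functions are
tested, so that operations involving higher derivatives are allowed. -/
structure SmoothTensorialAt {A : Type*} [AddCommGroup A] [Module ℝ A]
    (Φ : (Π x : M, TangentSpace 𝓘(ℝ, E) x) → A) (x : M) : Prop where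
  smul : ∀ {u : M → ℝ} {X : Π x : M, TangentSpace 𝓘(ℝ, E) x}, SmoothFunNear E u x →
    SmoothNear X x → Φ (u • X) = u x • Φ X
  add : ∀ {X Y : Π x : M, TangentSpace 𝓘(ℝ, E) x}, SmoothNear X x → SmoothNear Y x →
    Φ (X + Y) = Φ X + Φ Y

namespace SmoothTensorialAt

variable {A : Type*} [AddCommGroup A] [Module ℝ A]
  {Φ : (Π x : M, TangentSpace 𝓘(ℝ, E) x) → A}

theorem congr_germ (hΦ : SmoothTensorialAt Φ x) (hX : SmoothNear X x) (hY : SmoothNear Y x)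
    (h : ∀ᶠ y in 𝓝 x, X y = Y y) : Φ X = Φ Y := by
  classical
  let ψ (y : M) : ℝ := if X y = Y y then 1 else 0
  have hψx : ψ x = 1 := by simp [ψ, h.self_of_nhds]
  have h1 : ψ • X = ψ • Y := by
    ext y
    by_cases hy : X y = Y y <;> simp [ψ, hy]
  have hψ : SmoothFunNear E ψ x :=
    (smoothFunNear_const 1).congr (h.mono fun y hy ↦ by simp [ψ, hy])
  calc Φ X = Φ (ψ • X) := by rw [hΦ.smul hψ hX, hψx, one_smul]
    _ = Φ Y := by rw [h1, hΦ.smul hψ hY, hψx, one_smul]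

theorem zero (hΦ : SmoothTensorialAt Φ x) : Φ 0 = 0 := by
  simpa using hΦ.smul (u := fun _ ↦ 0) (smoothFunNear_const 0) .zero

theorem sum (hΦ : SmoothTensorialAt Φ x) {ι : Type*} (s : Finset ι)
    (X : ι → Π x : M, TangentSpace 𝓘(ℝ, E) x) (hX : ∀ i, SmoothNear (X i) x) :
    Φ (fun y ↦ ∑ i ∈ s, X i y) = ∑ i ∈ s, Φ (X i) := by
  classical
  induction s using Finset.induction_on with
  | empty => simpa using! hΦ.zero
  | insert a s ha h =>
    simp only [Finset.sum_insert ha, ← h]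
    exact hΦ.add (hX a) (.sum hX)

/-- A tensorial operation only depends on the value of the field at the point. -/
theorem pointwise (hΦ : SmoothTensorialAt Φ x) (hX : SmoothNear X x) (hY : SmoothNear Y x)
    (h : X x = Y x) : Φ X = Φ Y := by
  have key : ∀ {X : Π x : M, TangentSpace 𝓘(ℝ, E) x}, SmoothNear X x →
      Φ X = ∑ i, frameCoeff x i x (X x) • Φ (frameAt x i) := by
    intro X hX
    have h1 : ∀ i, SmoothNear ((fun y ↦ frameCoeff x i y (X y)) • frameAt x i) x := fun i ↦
      .smul (smoothFunNear_frameCoeff hX i) (smoothNear_frameAt i)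
    rw [hΦ.congr_germ hX (.sum h1)
      ((eventually_mem_baseSet x).mono fun y hy ↦ sum_frameCoeff_smul hy (X y)),
      hΦ.sum _ _ h1]
    exact Finset.sum_congr rfl fun i _ ↦
      hΦ.smul (smoothFunNear_frameCoeff hX i) (smoothNear_frameAt i)
  rw [key hX, key hY, h]

/-- The linear map on `T_x M` that a tensorial operation induces. -/
def toLinearMap (hΦ : SmoothTensorialAt Φ x) : TangentSpace 𝓘(ℝ, E) x →ₗ[ℝ] A where
  toFun v := Φ (extend E v)
  map_add' v w := by
    rw [← hΦ.add (smoothNear_extend v) (smoothNear_extend w)]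
    exact hΦ.pointwise (smoothNear_extend _) ((smoothNear_extend v).add (smoothNear_extend w))
      (by simp)
  map_smul' c v := by
    rw [RingHom.id_apply, ← hΦ.smul (smoothFunNear_const c) (smoothNear_extend v)]
    exact hΦ.pointwise (smoothNear_extend _) (.smul (smoothFunNear_const c) (smoothNear_extend v))
      (by simp)

theorem toLinearMap_apply (hΦ : SmoothTensorialAt Φ x) (hX : SmoothNear X x) :
    hΦ.toLinearMap (X x) = Φ X :=
  hΦ.pointwise (smoothNear_extend _) hX (by simp)

end SmoothTensorialAt

/-! ### Lie brackets as commutators, and exterior derivatives -/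

theorem jacobi_mlieBracket (hX : SmoothNear X x) (hY : SmoothNear Y x) (hZ : SmoothNear Z x) :
    mlieBracket 𝓘(ℝ, E) X (mlieBracket 𝓘(ℝ, E) Y Z) x =
      mlieBracket 𝓘(ℝ, E) (mlieBracket 𝓘(ℝ, E) X Y) Z x
        + mlieBracket 𝓘(ℝ, E) Y (mlieBracket 𝓘(ℝ, E) X Z) x := by
  have : IsManifold 𝓘(ℝ, E) (minSmoothness ℝ 3) M := by
    rw [minSmoothness_of_isRCLikeNormedField]; infer_instance
  have h2 : minSmoothness ℝ 2 ≤ ∞ := by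
    rw [minSmoothness_of_isRCLikeNormedField]; exact ENat.LEInfty.out
  exact leibniz_identity_mlieBracket_apply (hX.contMDiffAt.of_le h2) (hY.contMDiffAt.of_le h2)
    (hZ.contMDiffAt.of_le h2)

/-- `[X, Y] u = X (Y u) - Y (X u)`.  The identity is read off from the Jacobi identities for
`X, Y, Z` and `X, Y, u Z`, where `Z` is a field that does not vanish at the point. -/
theorem mvfderiv_mlieBracket (hu : SmoothFunNear E u x) (hX : SmoothNear X x)
    (hY : SmoothNear Y x) :
    d% u x (mlieBracket 𝓘(ℝ, E) X Y x) =
      d% (fun y ↦ d% u y (Y y)) x (X x) - d% (fun y ↦ d% u y (X y)) x (Y x) := by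
  rcases isEmpty_or_nonempty (Fin (finrank ℝ E)) with hE | ⟨⟨i⟩⟩
  · have : Subsingleton E := (finBasis ℝ E).repr.toEquiv.subsingleton
    have h0 : ∀ v : TangentSpace 𝓘(ℝ, E) x, v = 0 := fun v ↦ Subsingleton.elim (α := E) _ _
    rw [h0 (mlieBracket 𝓘(ℝ, E) X Y x), h0 (X x), h0 (Y x)]
    simp
  obtain ⟨Z, hZ, hZ0⟩ : ∃ Z : Π x : M, TangentSpace 𝓘(ℝ, E) x, SmoothNear Z x ∧ Z x ≠ 0 := by
    refine ⟨frameAt x i, smoothNear_frameAt i, ?_⟩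
    rw [← frameBasis_apply (FiberBundle.mem_baseSet_trivializationAt' x)]
    exact Basis.ne_zero _ i
  have key : ∀ {X Y : Π x : M, TangentSpace 𝓘(ℝ, E) x}, SmoothNear X x → SmoothNear Y x →
      mlieBracket 𝓘(ℝ, E) X (mlieBracket 𝓘(ℝ, E) Y (u • Z)) x =
        d% (fun y ↦ d% u y (Y y)) x (X x) • Z x
          + d% u x (Y x) • mlieBracket 𝓘(ℝ, E) X Z x
          + d% u x (X x) • mlieBracket 𝓘(ℝ, E) Y Z x
          + u x • mlieBracket 𝓘(ℝ, E) X (mlieBracket 𝓘(ℝ, E) Y Z) x := by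
    intro X Y hX hY
    have h1 : mlieBracket 𝓘(ℝ, E) Y (u • Z) =ᶠ[𝓝 x]
        (fun y ↦ d% u y (Y y)) • Z + u • mlieBracket 𝓘(ℝ, E) Y Z := by
      filter_upwards [hu.eventually, hZ.eventually] with y h1 h2
      exact mlieBracket_smul_right h1.mdiffAt h2.mdiffAt
    have hYu := hu.mvfderiv_apply hY
    have hYZ := hY.mlieBracket hZ
    have h2 : mlieBracket 𝓘(ℝ, E) X (mlieBracket 𝓘(ℝ, E) Y (u • Z)) x = mlieBracket 𝓘(ℝ, E) X
        ((fun y ↦ d% u y (Y y)) • Z + u • mlieBracket 𝓘(ℝ, E) Y Z) x :=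
      EventuallyEq.mlieBracket_vectorField_eq EventuallyEq.rfl h1
    rw [h2, mlieBracket_add_right (SmoothNear.smul hYu hZ).mdiffAt (SmoothNear.smul hu hYZ).mdiffAt,
      mlieBracket_smul_right hYu.mdiffAt hZ.mdiffAt, mlieBracket_smul_right hu.mdiffAt hYZ.mdiffAt]
    abel
  have h1 := jacobi_mlieBracket hX hY (.smul hu hZ)
  rw [key hX hY, key hY hX, mlieBracket_smul_right hu.mdiffAt hZ.mdiffAt,
    jacobi_mlieBracket hX hY hZ] at h1
  have h2 : (d% u x (mlieBracket 𝓘(ℝ, E) X Y x) -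
      (d% (fun y ↦ d% u y (Y y)) x (X x) - d% (fun y ↦ d% u y (X y)) x (Y x))) • Z x = 0 := by
    refine Eq.trans ?_ (neg_eq_zero.2 (sub_eq_zero.2 h1))
    module
  rcases smul_eq_zero.1 h2 with h3 | h3
  · exact sub_eq_zero.1 h3
  · exact absurd h3 hZ0

/-- Vanishing of the exterior derivative of the zero form: if `∑ i, a i db i = 0` near `x`, then
`∑ i, da i ∧ db i = 0` at `x`. -/
theorem sum_wedge_eq_zero_of_sum_smul_eq_zero {ι : Type*} [Fintype ι] {a b : ι → M → ℝ} {x : M}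
    (ha : ∀ i, SmoothFunNear E (a i) x) (hb : ∀ i, SmoothFunNear E (b i) x)
    (h : ∀ᶠ y in 𝓝 x, ∀ v : TangentSpace 𝓘(ℝ, E) y, ∑ i, a i y * d% (b i) y v = 0)
    (v w : TangentSpace 𝓘(ℝ, E) x) :
    ∑ i, (d% (a i) x v * d% (b i) x w - d% (a i) x w * d% (b i) x v) = 0 := by
  have key : ∀ {V W : Π y : M, TangentSpace 𝓘(ℝ, E) y}, SmoothNear V x → SmoothNear W x →
      ∑ i, (a i x * d% (fun y ↦ d% (b i) y (W y)) x (V x)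
        + d% (b i) x (W x) * d% (a i) x (V x)) = 0 := by
    intro V W hV hW
    have h1 : ∀ᶠ y in 𝓝 x, ∑ i, (a i * fun z ↦ d% (b i) z (W z)) y = (fun _ ↦ (0 : ℝ)) y :=
      h.mono fun y hy ↦ hy (W y)
    have h2 := DFunLike.congr_fun (mvfderiv_congr (E := E) h1) (V x)
    rw [mvfderiv_sum fun i ↦ (ha i).mul ((hb i).mvfderiv_apply hW), mvfderiv_const,
      sum_apply] at h2
    simpa only [mvfderiv_mul (ha _).mdiffAt ((hb _).mvfderiv_apply hW).mdiffAt, add_apply,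
      FunLike.coe_smul, Pi.smul_apply, smul_eq_mul, zero_apply] using h2
  have hV := smoothNear_extend v
  have hW := smoothNear_extend w
  have h1 := key hV hW
  have h2 := key hW hV
  have h3 := h.self_of_nhds (mlieBracket 𝓘(ℝ, E) (extend E v) (extend E w) x)
  simp only [mvfderiv_mlieBracket (hb _) hV hW] at h3
  simp only [extend_apply_self] at h1 h2 h3
  have h4 := congrArg₂ (· - ·) (congrArg₂ (· - ·) h1 h2) h3
  simp only [← Finset.sum_sub_distrib, sub_zero] at h4
  rw [← h4]
  exact Finset.sum_congr rfl fun i _ ↦ by ring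

/-- Every covector at `x` is the differential of a smooth function that vanishes at `x`. -/
theorem exists_mvfderiv_eq (ℓ : TangentSpace 𝓘(ℝ, E) x →L[ℝ] ℝ) :
    ∃ u : M → ℝ, SmoothFunNear E u x ∧ u x = 0 ∧ d% u x = ℓ := by
  let L : E →L[ℝ] ℝ := ℓ
  refine ⟨fun y ↦ L (extChartAt 𝓘(ℝ, E) x y) - L (extChartAt 𝓘(ℝ, E) x x), ?_, by simp, ?_⟩
  · filter_upwards [chart_source_mem_nhds E x] with y hy
    exact (L.contMDiff.contMDiffAt.comp y (contMDiffAt_extChartAt' hy)).sub contMDiffAt_const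
  · have h1 : MDifferentiableAt 𝓘(ℝ, E) 𝓘(ℝ, E) (extChartAt 𝓘(ℝ, E) x) x :=
      mdifferentiableAt_extChartAt (mem_chart_source E x)
    have h2 : MDifferentiableAt 𝓘(ℝ, E) 𝓘(ℝ, ℝ) L (extChartAt 𝓘(ℝ, E) x x) :=
      L.contMDiff.mdifferentiable (n := ∞) (by simp) _
    have h3 := mvfderiv_sub (h2.comp x h1)
      (mdifferentiableAt_const (c := L (extChartAt 𝓘(ℝ, E) x x)))
    refine h3.trans ?_
    ext v
    rw [mvfderiv_const, sub_zero, mvfderiv_comp_apply x h2 h1, mfderiv_extChartAt_self]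
    change mfderiv 𝓘(ℝ, E) 𝓘(ℝ, ℝ) L _ v = L v
    rw [mfderiv_eq_fderiv, L.fderiv]
    rfl

variable [RiemannianBundle (fun x : M ↦ TangentSpace 𝓘(ℝ, E) x)]
  [IsContMDiffRiemannianBundle 𝓘(ℝ, E) ∞ E (fun x : M ↦ TangentSpace 𝓘(ℝ, E) x)]

/-! ### Smoothness of the Levi-Civita connection and of gradients -/

theorem SmoothNear.innerField (hX : SmoothNear X x) (hY : SmoothNear Y x) :
    SmoothFunNear E (innerField X Y) x := by
  filter_upwards [hX, hY] with y h1 h2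
  exact ContMDiffAt.inner_bundle (F := E) (E := fun x : M ↦ TangentSpace 𝓘(ℝ, E) x) h1 h2

/-- A vector field is smooth if its inner products with the members of a smooth local frame are:
by Cramer's rule its coefficients are rational functions of these and of the Gram matrix. -/
theorem smoothNear_of_inner
    (h : ∀ i, SmoothFunNear E (RicciHessian.innerField V (frameAt x i)) x) : SmoothNear V x := by
  classical
  let G : M → Matrix (Fin (finrank ℝ E)) (Fin (finrank ℝ E)) ℝ := fun y ↦
    Matrix.of fun i j ↦ inner ℝ (frameAt (E := E) x i y) (frameAt x j y)
  let b : M → Fin (finrank ℝ E) → ℝ := fun y i ↦ inner ℝ (V y) (frameAt x i y)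
  have hG : ∀ i j, SmoothFunNear E (fun y ↦ G y i j) x := fun i j ↦
    (smoothNear_frameAt (E := E) i).innerField (smoothNear_frameAt (E := E) j)
  have hdet : ∀ᶠ y in 𝓝 x, (G y).det ≠ 0 := by
    filter_upwards [eventually_mem_baseSet (E := E) x] with y hy
    have h1 : LinearIndependent ℝ (fun i ↦ frameAt (E := E) x i y) := by
      have := (frameBasis hy).linearIndependent
      simpa only [funext (frameBasis_apply hy)] using this
    exact ((Matrix.posDef_gram_iff_linearIndependent).2 h1).det_pos.ne'
  have hc : ∀ i, SmoothFunNear E (fun y ↦ ((G y).det)⁻¹ * ((G y).cramer (b y) i)) x := by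
    intro i
    refine ((SmoothFunNear.det hG).inv hdet.self_of_nhds).mul ?_
    simp only [Matrix.cramer_apply]
    refine .det fun j k ↦ ?_
    by_cases hk : k = i
    · subst hk
      simpa [Matrix.updateCol_apply] using! h j
    · simpa [Matrix.updateCol_apply, hk] using! hG j k
  refine (SmoothNear.sum (s := Finset.univ) fun i ↦
    (SmoothNear.smul (hc i) (smoothNear_frameAt i))).congr ?_
  filter_upwards [eventually_mem_baseSet (E := E) x, hdet] with y hy hy0
  have hb : b y = (G y).mulVec (fun i ↦ frameCoeff x i y (V y)) := by
    ext j
    conv_lhs => simp only [b]; rw [sum_frameCoeff_smul hy (V y)]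
    simp only [sum_inner, inner_smul_left, Matrix.mulVec, dotProduct, G, Matrix.of_apply]
    refine Finset.sum_congr rfl fun i _ ↦ ?_
    rw [real_inner_comm]
    simp [mul_comm]
  conv_lhs => rw [sum_frameCoeff_smul hy (V y)]
  refine Finset.sum_congr rfl fun i _ ↦ ?_
  simp only [Pi.smul_apply']
  congr 1
  rw [hb, Matrix.cramer_eq_adjugate_mulVec, Matrix.mulVec_mulVec, Matrix.adjugate_mul,
    Matrix.smul_mulVec, Matrix.one_mulVec]
  simp [hy0]

theorem SmoothNear.koszul (hX : SmoothNear X x) (hY : SmoothNear Y x) (hZ : SmoothNear Z x) :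
    SmoothFunNear E (fun y ↦ koszul y Y X Z) x := by
  have h := (smoothFunNear_const (E := E) (x := x) (1 / 2)).mul
    ((((((hY.innerField hZ).mvfderiv_apply hX).add ((hZ.innerField hX).mvfderiv_apply hY)).sub
      ((hX.innerField hY).mvfderiv_apply hZ)).add ((hX.mlieBracket hY).innerField hZ)).sub
      ((hY.mlieBracket hZ).innerField hX)|>.add ((hZ.mlieBracket hX).innerField hY))
  exact h

theorem SmoothNear.leviCivita (hX : SmoothNear X x) (hY : SmoothNear Y x) :
    SmoothNear (fun y ↦ leviCivita Y y (X y)) x := by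
  refine smoothNear_of_inner fun i ↦ ?_
  refine (hX.koszul hY (smoothNear_frameAt i)).congr ?_
  filter_upwards [hX.eventually, hY.eventually, (smoothNear_frameAt (E := E) i).eventually]
    with y h1 h2 h3
  exact inner_leviCivita h2.mdiffAt h1.mdiffAt h3.mdiffAt

theorem inner_grad (v : TangentSpace 𝓘(ℝ, E) x) : inner ℝ (grad u x) v = d% u x v :=
  InnerProductSpace.toDual_symm_apply

theorem SmoothFunNear.grad (hu : SmoothFunNear E u x) :
    SmoothNear (grad u : Π y : M, TangentSpace 𝓘(ℝ, E) y) x := by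
  refine smoothNear_of_inner fun i ↦ ?_
  exact (hu.mvfderiv_apply (smoothNear_frameAt i)).congr (Eventually.of_forall fun y ↦
    inner_grad _)

/-! ### Calculus of the Levi-Civita connection -/

/-- The vector field `∇_X Y`. -/
abbrev nabla (X Y : Π x : M, TangentSpace 𝓘(ℝ, E) x) : Π x : M, TangentSpace 𝓘(ℝ, E) x :=
  fun y ↦ leviCivita Y y (X y)

theorem leviCivita_add (hY : SmoothNear Y x) (hZ : SmoothNear Z x) :
    leviCivita (Y + Z) x = leviCivita Y x + leviCivita Z x :=
  leviCivita.isCovariantDerivativeOnUniv.add hY.mdiffAt hZ.mdiffAt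

theorem leviCivita_smul (hu : SmoothFunNear E u x) (hY : SmoothNear Y x)
    (v : TangentSpace 𝓘(ℝ, E) x) :
    leviCivita (u • Y) x v = u x • leviCivita Y x v + d% u x v • Y x := by
  have := leviCivita.isCovariantDerivativeOnUniv.leibniz hY.mdiffAt hu.mdiffAt
  exact DFunLike.congr_fun this v

theorem leviCivita_sub (hY : SmoothNear Y x) (hZ : SmoothNear Z x) :
    leviCivita (Y - Z) x = leviCivita Y x - leviCivita Z x := by
  have h := leviCivita_add (hY.sub hZ) hZ
  rw [sub_add_cancel] at h
  rw [h, add_sub_cancel_right]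

theorem leviCivita_neg (hY : SmoothNear Y x) : leviCivita (-Y) x = -leviCivita Y x := by
  have h := leviCivita_sub .zero hY
  rwa [zero_sub, (leviCivita (E := E) (M := M)).zero, Pi.zero_apply, zero_sub] at h

theorem leviCivita_congr (hZ : SmoothNear Z x) (h : ∀ᶠ y in 𝓝 x, Y y = Z y) :
    leviCivita Y x = leviCivita Z x :=
  (leviCivita.isCovariantDerivativeOn (s := Set.univ)).congr_of_eventuallyEq
    (hZ.congr h).mdiffAt hZ.mdiffAt univ_mem h

theorem leviCivita_sum {ι : Type*} {s : Finset ι} {X : ι → Π x : M, TangentSpace 𝓘(ℝ, E) x}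
    (hX : ∀ i, SmoothNear (X i) x) :
    leviCivita (fun y ↦ ∑ i ∈ s, X i y) x = ∑ i ∈ s, leviCivita (X i) x := by
  classical
  induction s using Finset.induction_on with
  | empty =>
    simp only [Finset.sum_empty]
    exact congrFun (leviCivita (E := E) (M := M)).zero x
  | insert j s hj h =>
    simp only [Finset.sum_insert hj, ← h]
    exact leviCivita_add (hX j) (.sum hX)

theorem nabla_sub_nabla (hX : SmoothNear X x) (hY : SmoothNear Y x) :
    nabla X Y x - nabla Y X x = mlieBracket 𝓘(ℝ, E) X Y x :=
  (CovariantDerivative.torsion_eq_zero_iff _).1 torsion_leviCivita hX.mdiffAt hY.mdiffAt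

theorem mlieBracket_eq_zero (hX : SmoothNear X x) (hY : SmoothNear Y x)
    (hX0 : leviCivita X x = 0) (hY0 : leviCivita Y x = 0) : mlieBracket 𝓘(ℝ, E) X Y x = 0 := by
  rw [← nabla_sub_nabla hX hY]
  simp [nabla, hX0, hY0]

theorem mvfderiv_innerField_apply (hY : SmoothNear Y x) (hZ : SmoothNear Z x)
    (v : TangentSpace 𝓘(ℝ, E) x) :
    d% (innerField Y Z) x v
      = inner ℝ (leviCivita Y x v) (Z x) + inner ℝ (Y x) (leviCivita Z x v) := by
  simpa using mvfderiv_innerField (mdiffAt_extend v) hY.mdiffAt hZ.mdiffAt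

/-- Every tangent vector at `x` is the value of a smooth field whose covariant derivative vanishes
at `x`. -/
theorem exists_parallel (v : TangentSpace 𝓘(ℝ, E) x) :
    ∃ V : Π y : M, TangentSpace 𝓘(ℝ, E) y, SmoothNear V x ∧ V x = v ∧ leviCivita V x = 0 := by
  choose a ha ha0 hda using fun i ↦ exists_mvfderiv_eq
    ((LinearMap.toContinuousLinearMap (frameCoeff x i x)).comp
      (leviCivita (extend E v : Π y : M, TangentSpace 𝓘(ℝ, E) y) x))
  have hs : ∀ i, SmoothNear (a i • frameAt (E := E) x i) x := fun i ↦
    .smul (ha i) (smoothNear_frameAt i)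
  -- The coefficients `a i` vanish at `x`; their differentials are the components of `∇ V₀` for the
  -- arbitrary extension `V₀` of `v`, so subtracting `∑ a i • frameAt x i` removes its covariant derivative.
  refine ⟨extend E v - fun y ↦ ∑ i, (a i • frameAt x i) y, (smoothNear_extend v).sub (.sum hs),
    by simp [ha0], ?_⟩
  rw [leviCivita_sub (smoothNear_extend v) (.sum hs), sub_eq_zero]
  ext z
  rw [leviCivita_sum hs, sum_apply,
    sum_frameCoeff_smul (FiberBundle.mem_baseSet_trivializationAt' x)
      (leviCivita (extend E v) x z)]
  refine Finset.sum_congr rfl fun i _ ↦ ?_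
  rw [leviCivita_smul (ha i) (smoothNear_frameAt i), ha0, hda]
  simp

/-! ### The curvature tensor and its symmetries -/

theorem SmoothNear.riemann (hX : SmoothNear X x) (hY : SmoothNear Y x) (hZ : SmoothNear Z x) :
    SmoothNear (riemann X Y Z) x :=
  ((hX.leviCivita (hY.leviCivita hZ)).sub (hY.leviCivita (hX.leviCivita hZ))).sub
    ((hX.mlieBracket hY).leviCivita hZ)

theorem riemann_swap : riemann X Y Z x = -riemann Y X Z x := by
  simp only [riemann]
  rw [mlieBracket_swap_apply]
  simp only [map_neg]
  abel

theorem riemann_tensorial_left (hZ : SmoothNear Z x) :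
    SmoothTensorialAt (fun X ↦ riemann X Y Z x) x where
  add {X X'} hX hX' := by
    have h : (fun y ↦ leviCivita Z y ((X + X') y)) = nabla X Z + nabla X' Z := by
      ext y; simp
    simp only [riemann]
    rw [h, leviCivita_add (hX.leviCivita hZ) (hX'.leviCivita hZ),
      mlieBracket_add_left hX.mdiffAt hX'.mdiffAt]
    simp
    abel
  smul {u X} hu hX := by
    have h : (fun y ↦ leviCivita Z y ((u • X) y)) = u • nabla X Z := by
      ext y; simp
    simp only [riemann]
    rw [h, leviCivita_smul hu (hX.leviCivita hZ), mlieBracket_smul_left hu.mdiffAt hX.mdiffAt]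
    simp
    module

theorem riemann_tensorial_right (hX : SmoothNear X x) (hY : SmoothNear Y x) :
    SmoothTensorialAt (fun Z ↦ riemann X Y Z x) x where
  add {Z Z'} hZ hZ' := by
    have h : ∀ {X : Π x : M, TangentSpace 𝓘(ℝ, E) x}, SmoothNear X x →
        ∀ᶠ y in 𝓝 x, nabla X (Z + Z') y = (nabla X Z + nabla X Z') y := by
      intro X hX
      filter_upwards [hZ.eventually, hZ'.eventually] with y h1 h2
      simp [nabla, leviCivita_add h1 h2]
    simp only [riemann]
    rw [leviCivita_congr ((hX.leviCivita hZ).add (hX.leviCivita hZ')) (h hX),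
      leviCivita_congr ((hY.leviCivita hZ).add (hY.leviCivita hZ')) (h hY),
      leviCivita_add (hX.leviCivita hZ) (hX.leviCivita hZ'),
      leviCivita_add (hY.leviCivita hZ) (hY.leviCivita hZ'), leviCivita_add hZ hZ']
    simp
    abel
  smul {u Z} hu hZ := by
    have h : ∀ {X : Π x : M, TangentSpace 𝓘(ℝ, E) x}, SmoothNear X x →
        ∀ᶠ y in 𝓝 x, nabla X (u • Z) y
          = (u • nabla X Z + (fun z ↦ d% u z (X z)) • Z) y := by
      intro X hX
      filter_upwards [hu.eventually, hZ.eventually] with y h1 h2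
      simp [nabla, leviCivita_smul h1 h2]
    have h' : ∀ {X Y : Π x : M, TangentSpace 𝓘(ℝ, E) x}, SmoothNear X x → SmoothNear Y x →
        leviCivita (nabla Y (u • Z)) x (X x) = u x • nabla X (nabla Y Z) x
          + d% u x (X x) • nabla Y Z x + d% u x (Y x) • nabla X Z x
          + d% (fun z ↦ d% u z (Y z)) x (X x) • Z x := by
      intro X Y hX hY
      have h1 := SmoothNear.smul hu (hY.leviCivita hZ)
      have h2 := hu.mvfderiv_apply hY
      rw [leviCivita_congr (h1.add (.smul h2 hZ)) (h hY), leviCivita_add h1 (.smul h2 hZ),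
        add_apply, leviCivita_smul hu (hY.leviCivita hZ),
        leviCivita_smul h2 hZ]
      abel
    have h3 := h' hX hY
    have h4 := h' hY hX
    simp only [nabla] at h3 h4
    simp only [riemann]
    rw [h3, h4, leviCivita_smul hu hZ, mvfderiv_mlieBracket hu hX hY]
    module

theorem riemann_congr (hX : SmoothNear X x) (hY : SmoothNear Y x) (hZ : SmoothNear Z x)
    (hX' : SmoothNear X' x) (hY' : SmoothNear Y' x) (hZ' : SmoothNear Z' x)
    (h1 : X x = X' x) (h2 : Y x = Y' x) (h3 : Z x = Z' x) :
    riemann X Y Z x = riemann X' Y' Z' x := by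
  rw [(riemann_tensorial_left hZ).pointwise hX hX' h1, riemann_swap,
    (riemann_tensorial_left hZ).pointwise hY hY' h2, riemann_swap, neg_neg]
  exact (riemann_tensorial_right hX' hY').pointwise hZ hZ' h3

/-- `g(Rm(X, Y) Z, W)` is antisymmetric in `Z` and `W`: apply `X Y - Y X - [X, Y] = 0` to the
function `g(Z, W)`. -/
theorem inner_riemann_antisymm (hX : SmoothNear X x) (hY : SmoothNear Y x) (hZ : SmoothNear Z x)
    (hW : SmoothNear W x) :
    inner ℝ (riemann X Y Z x) (W x) = -inner ℝ (Z x) (riemann X Y W x) := by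
  have key : ∀ {X Y : Π x : M, TangentSpace 𝓘(ℝ, E) x}, SmoothNear X x → SmoothNear Y x →
      d% (fun y ↦ d% (innerField Z W) y (Y y)) x (X x) =
        inner ℝ (nabla X (nabla Y Z) x) (W x) + inner ℝ (nabla Y Z x) (nabla X W x)
        + (inner ℝ (nabla X Z x) (nabla Y W x) + inner ℝ (Z x) (nabla X (nabla Y W) x)) := by
    intro X Y hX hY
    have h : ∀ᶠ y in 𝓝 x, d% (innerField Z W) y (Y y)
        = (innerField (nabla Y Z) W + innerField Z (nabla Y W)) y := by
      filter_upwards [hZ.eventually, hW.eventually] with y h1 h2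
      exact mvfderiv_innerField_apply h1 h2 _
    have hYZ : SmoothNear (nabla Y Z) x := hY.leviCivita hZ
    have hYW : SmoothNear (nabla Y W) x := hY.leviCivita hW
    rw [mvfderiv_congr h, mvfderiv_add (hYZ.innerField hW).mdiffAt (hZ.innerField hYW).mdiffAt,
      add_apply, mvfderiv_innerField_apply hYZ hW,
      mvfderiv_innerField_apply hZ hYW]
  have h1 := mvfderiv_mlieBracket (hZ.innerField hW) hX hY
  rw [key hX hY, key hY hX, mvfderiv_innerField_apply hZ hW] at h1
  simp only [riemann, inner_sub_left, inner_sub_right]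
  simp only [nabla] at h1
  linarith

/-- The second Bianchi identity at a point where the covariant derivatives of the four fields
vanish. -/
theorem second_bianchi (hX : SmoothNear X x) (hY : SmoothNear Y x) (hZ : SmoothNear Z x)
    (hW : SmoothNear W x) (hX0 : leviCivita X x = 0) (hY0 : leviCivita Y x = 0)
    (hZ0 : leviCivita Z x = 0) (hW0 : leviCivita W x = 0) :
    nabla X (riemann Y Z W) x + nabla Y (riemann Z X W) x + nabla Z (riemann X Y W) x = 0 := by
  -- `Rm(X, Y) ∇_Z W` vanishes at `x` because `∇_Z W` does.
  have h1 : ∀ {X Y Z : Π x : M, TangentSpace 𝓘(ℝ, E) x}, SmoothNear X x → SmoothNear Y x →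
      SmoothNear Z x → leviCivita X x = 0 → leviCivita Y x = 0 →
      nabla X (nabla Y (nabla Z W)) x = nabla Y (nabla X (nabla Z W)) x := by
    intro X Y Z hX hY hZ hX0 hY0
    have h := (riemann_tensorial_right hX hY).pointwise (hZ.leviCivita hW) .zero (by simp [hW0])
    simp only [(riemann_tensorial_right hX hY).zero] at h
    simp only [riemann, mlieBracket_eq_zero hX hY hX0 hY0, map_zero, sub_zero] at h
    exact sub_eq_zero.1 h
  -- `Rm(Z, [X, Y]) W` vanishes at `x` because `[X, Y]` does.
  have h2 : ∀ {X Y Z : Π x : M, TangentSpace 𝓘(ℝ, E) x}, SmoothNear X x → SmoothNear Y x →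
      SmoothNear Z x → leviCivita X x = 0 → leviCivita Y x = 0 →
      nabla Z (nabla (mlieBracket 𝓘(ℝ, E) X Y) W) x = 0 := by
    intro X Y Z hX hY hZ hX0 hY0
    have hB := hX.mlieBracket hY
    have hB0 := mlieBracket_eq_zero hX hY hX0 hY0
    have h := (riemann_tensorial_left (Y := Z) hW).pointwise hB .zero (by simp [hB0])
    simp only [(riemann_tensorial_left (Y := Z) hW).zero] at h
    rw [riemann_swap, neg_eq_zero] at h
    simpa [riemann, hB0, hW0] using h
  have h3 : ∀ {X Y Z : Π x : M, TangentSpace 𝓘(ℝ, E) x}, SmoothNear X x → SmoothNear Y x →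
      SmoothNear Z x → nabla X (riemann Y Z W) x = nabla X (nabla Y (nabla Z W)) x
        - nabla X (nabla Z (nabla Y W)) x - nabla X (nabla (mlieBracket 𝓘(ℝ, E) Y Z) W) x := by
    intro X Y Z hX hY hZ
    have e : riemann Y Z W = nabla Y (nabla Z W) - nabla Z (nabla Y W)
      - nabla (mlieBracket 𝓘(ℝ, E) Y Z) W := rfl
    have a1 : SmoothNear (nabla Y (nabla Z W)) x := hY.leviCivita (hZ.leviCivita hW)
    have a2 : SmoothNear (nabla Z (nabla Y W)) x := hZ.leviCivita (hY.leviCivita hW)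
    have a3 : SmoothNear (nabla (mlieBracket 𝓘(ℝ, E) Y Z) W) x :=
      (hY.mlieBracket hZ).leviCivita hW
    simp only [e, nabla] at a1 a2 a3 ⊢
    rw [leviCivita_sub (a1.sub a2) a3, leviCivita_sub a1 a2]
    simp
  rw [h3 hX hY hZ, h3 hY hZ hX, h3 hZ hX hY, h2 hY hZ hX hY0 hZ0, h2 hZ hX hY hZ0 hX0,
    h2 hX hY hZ hX0 hY0, h1 hX hY hZ hX0 hY0, h1 hY hZ hX hY0 hZ0, h1 hZ hX hY hZ0 hX0]
  abel

section Trace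

/-! ### Derivatives of traces -/

/-- A field `A` of endomorphisms of the tangent spaces is smooth near `x`: it maps smooth vector
fields to smooth vector fields. -/
def SmoothEndNear (A : Π y : M, TangentSpace 𝓘(ℝ, E) y →ₗ[ℝ] TangentSpace 𝓘(ℝ, E) y) (x : M) :
    Prop :=
  ∀ V : Π y : M, TangentSpace 𝓘(ℝ, E) y, SmoothNear V x → SmoothNear (fun y ↦ A y (V y)) x

variable {A : Π y : M, TangentSpace 𝓘(ℝ, E) y →ₗ[ℝ] TangentSpace 𝓘(ℝ, E) y}

theorem trace_eq_sum_frameCoeff {x y : M}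
    (hy : y ∈ (trivializationAt E (TangentSpace 𝓘(ℝ, E) : M → Type _) x).baseSet)
    (T : TangentSpace 𝓘(ℝ, E) y →ₗ[ℝ] TangentSpace 𝓘(ℝ, E) y) :
    LinearMap.trace ℝ _ T = ∑ j, frameCoeff x j y (T (frameAt x j y)) := by
  rw [LinearMap.trace_eq_matrix_trace ℝ (frameBasis hy), Matrix.trace]
  refine Finset.sum_congr rfl fun j _ ↦ ?_
  rw [Matrix.diag_apply, LinearMap.toMatrix_apply, frameCoeff_apply hy, frameBasis_apply]

theorem SmoothEndNear.trace (hA : SmoothEndNear A x) :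
    SmoothFunNear E (fun y ↦ LinearMap.trace ℝ _ (A y)) x := by
  refine (SmoothFunNear.sum (s := Finset.univ) fun j ↦
    smoothFunNear_frameCoeff (hA _ (smoothNear_frameAt (E := E) j)) j).congr ?_
  exact (eventually_mem_baseSet x).mono fun y hy ↦ trace_eq_sum_frameCoeff hy (A y)

/-- `W ↦ ∇_v (A W) - A (∇_v W)` is tensorial. -/
theorem SmoothEndNear.tensorial (hA : SmoothEndNear A x) (v : TangentSpace 𝓘(ℝ, E) x) :
    SmoothTensorialAt
      (fun W ↦ leviCivita (fun y ↦ A y (W y)) x v - A x (leviCivita W x v)) x where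
  add {W W'} hW hW' := by
    have h : (fun y ↦ A y ((W + W') y)) = (fun y ↦ A y (W y)) + fun y ↦ A y (W' y) := by
      ext y; simp
    rw [h, leviCivita_add (hA _ hW) (hA _ hW'), leviCivita_add hW hW']
    simp
    abel
  smul {u W} hu hW := by
    have h : (fun y ↦ A y ((u • W) y)) = u • fun y ↦ A y (W y) := by
      ext y; simp
    rw [h, leviCivita_smul hu (hA _ hW), leviCivita_smul hu hW]
    simp
    module

/-- The covariant derivative `∇_v A` of a smooth field of endomorphisms. -/
def SmoothEndNear.covDeriv (hA : SmoothEndNear A x) (v : TangentSpace 𝓘(ℝ, E) x) :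
    TangentSpace 𝓘(ℝ, E) x →ₗ[ℝ] TangentSpace 𝓘(ℝ, E) x :=
  (hA.tensorial v).toLinearMap

theorem SmoothEndNear.covDeriv_apply (hA : SmoothEndNear A x) (v : TangentSpace 𝓘(ℝ, E) x)
    (hW : SmoothNear W x) :
    hA.covDeriv v (W x) = leviCivita (fun y ↦ A y (W y)) x v - A x (leviCivita W x v) :=
  (hA.tensorial v).toLinearMap_apply hW

/-- `d (tr A) = tr (∇ A)`.  In a local frame the connection matrix `N` contributes
`tr (A N) - tr (N A) = 0`. -/
theorem SmoothEndNear.mvfderiv_trace (hA : SmoothEndNear A x) (v : TangentSpace 𝓘(ℝ, E) x) :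
    d% (fun y ↦ LinearMap.trace ℝ _ (A y)) x v = LinearMap.trace ℝ _ (hA.covDeriv v) := by
  have hx := FiberBundle.mem_baseSet_trivializationAt' (F := E)
    (E := (TangentSpace 𝓘(ℝ, E) : M → Type _)) x
  have he := fun i ↦ smoothNear_frameAt (E := E) (x := x) i
  let N : TangentSpace 𝓘(ℝ, E) x →ₗ[ℝ] TangentSpace 𝓘(ℝ, E) x :=
    ∑ k, (frameCoeff x k x).smulRight (leviCivita (frameAt x k) x v)
  have hδ : ∀ j k, frameCoeff (E := E) x j x (frameAt x k x) = if k = j then 1 else 0 := by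
    intro j k
    rw [frameCoeff_apply hx, ← frameBasis_apply hx, Basis.repr_self, Finsupp.single_apply]
  have hN : ∀ j, N (frameAt x j x) = leviCivita (frameAt x j) x v := by
    intro j
    simp [N, hδ]
  have hcoeff : ∀ {F : Π y : M, TangentSpace 𝓘(ℝ, E) y}, SmoothNear F x → ∀ j,
      d% (fun y ↦ frameCoeff x j y (F y)) x v
        = frameCoeff x j x (leviCivita F x v) - frameCoeff x j x (N (F x)) := by
    intro F hF j
    have hc := fun k ↦ smoothFunNear_frameCoeff hF k
    have hs : ∀ k, SmoothNear ((fun y ↦ frameCoeff x k y (F y)) • frameAt x k) x := fun k ↦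
      .smul (hc k) (he k)
    have h1 : leviCivita F x v
        = N (F x) + ∑ k, d% (fun y ↦ frameCoeff x k y (F y)) x v • frameAt x k x := by
      rw [leviCivita_congr (.sum hs)
        ((eventually_mem_baseSet x).mono fun y hy ↦ sum_frameCoeff_smul hy (F y)),
        leviCivita_sum hs, sum_apply]
      simp only [leviCivita_smul (hc _) (he _), Finset.sum_add_distrib]
      simp [N]
    rw [h1]
    simp [hδ]
  have h2 : ∀ᶠ y in 𝓝 x, LinearMap.trace ℝ _ (A y)
      = ∑ j, frameCoeff x j y (A y (frameAt x j y)) :=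
    (eventually_mem_baseSet x).mono fun y hy ↦ trace_eq_sum_frameCoeff hy (A y)
  have h3 : ∀ j, d% (fun y ↦ frameCoeff x j y (A y (frameAt x j y))) x v
      = frameCoeff x j x ((hA.covDeriv v + A x * N - N * A x) (frameAt x j x)) := by
    intro j
    rw [hcoeff (hA _ (he j)) j, ← map_sub]
    congr 1
    simp only [LinearMap.sub_apply, LinearMap.add_apply, Module.End.mul_apply, hN,
      hA.covDeriv_apply v (he j)]
    abel
  rw [mvfderiv_congr h2, mvfderiv_sum fun j ↦ smoothFunNear_frameCoeff (hA _ (he j)) j,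
    sum_apply, Finset.sum_congr rfl fun j _ ↦ h3 j,
    ← trace_eq_sum_frameCoeff hx, map_sub, map_add, LinearMap.trace_mul_comm]
  simp

/-- The derivative of a trace, in an orthonormal frame whose covariant derivatives vanish at the
point. -/
theorem SmoothEndNear.mvfderiv_trace_eq_sum {ι : Type*} [Fintype ι] (hA : SmoothEndNear A x)
    (e : OrthonormalBasis ι ℝ (TangentSpace 𝓘(ℝ, E) x))
    {F : ι → Π y : M, TangentSpace 𝓘(ℝ, E) y} (hF : ∀ i, SmoothNear (F i) x)
    (hFx : ∀ i, F i x = e i) (hF0 : ∀ i, leviCivita (F i) x = 0) (v : TangentSpace 𝓘(ℝ, E) x) :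
    d% (fun y ↦ LinearMap.trace ℝ _ (A y)) x v
      = ∑ i, inner ℝ (leviCivita (fun y ↦ A y (F i y)) x v) (e i) := by
  rw [hA.mvfderiv_trace, LinearMap.trace_eq_sum_inner _ e]
  refine Finset.sum_congr rfl fun i _ ↦ ?_
  rw [← hFx, hA.covDeriv_apply v (hF i), hF0, real_inner_comm]
  simp

/-- The endomorphism `v ↦ Rm(v, z) w` of `T_x M`. -/
def curvatureEnd (x : M) (z w : TangentSpace 𝓘(ℝ, E) x) :
    TangentSpace 𝓘(ℝ, E) x →ₗ[ℝ] TangentSpace 𝓘(ℝ, E) x :=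
  (riemann_tensorial_left (Y := extend E z) (smoothNear_extend w)).toLinearMap

theorem curvatureEnd_apply (hV : SmoothNear V x) (hZ : SmoothNear Z x) (hW : SmoothNear W x) :
    curvatureEnd x (Z x) (W x) (V x) = riemann V Z W x :=
  riemann_congr (smoothNear_extend _) (smoothNear_extend _) (smoothNear_extend _) hV hZ hW
    (by simp) (by simp) (by simp)

theorem ricci_eq_trace (z w : TangentSpace 𝓘(ℝ, E) x) :
    ricci x z w = LinearMap.trace ℝ _ (curvatureEnd x z w) := by
  rw [LinearMap.trace_eq_sum_inner _ (stdOrthonormalBasis ℝ (TangentSpace 𝓘(ℝ, E) x))]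
  refine Finset.sum_congr rfl fun i _ ↦ ?_
  rw [real_inner_comm]
  rfl

theorem smoothEndNear_curvatureEnd (hZ : SmoothNear Z x) (hW : SmoothNear W x) :
    SmoothEndNear (fun y ↦ curvatureEnd y (Z y) (W y)) x := by
  intro V hV
  refine (hV.riemann hZ hW).congr ?_
  filter_upwards [hV.eventually, hZ.eventually, hW.eventually] with y h1 h2 h3
  exact curvatureEnd_apply h1 h2 h3

theorem smoothEndNear_leviCivita (hW : SmoothNear W x) :
    SmoothEndNear (fun y ↦ (leviCivita W y).toLinearMap) x :=
  fun _ hV ↦ hV.leviCivita hW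

end Trace

section NormalFrame

/-! ### The contracted Bianchi and Ricci identities in a normal frame -/

/-- A family of vector fields, smooth near `x`, whose values at `x` form the orthonormal basis `e`
and whose covariant derivatives vanish at `x`. -/
structure IsNormalFrameAt {ι : Type*} [Fintype ι]
    (e : OrthonormalBasis ι ℝ (TangentSpace 𝓘(ℝ, E) x))
    (F : ι → Π y : M, TangentSpace 𝓘(ℝ, E) y) : Prop where
  smooth : ∀ i, SmoothNear (F i) x
  eq_basis : ∀ i, F i x = e i
  leviCivita_eq_zero : ∀ i, leviCivita (F i) x = 0

theorem exists_isNormalFrameAt {ι : Type*} [Fintype ι]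
    (e : OrthonormalBasis ι ℝ (TangentSpace 𝓘(ℝ, E) x)) : ∃ F, IsNormalFrameAt e F := by
  choose F h1 h2 h3 using fun i ↦ exists_parallel (e i)
  exact ⟨F, h1, h2, h3⟩

theorem mvfderiv_gradInner (hu : SmoothFunNear E u x) (hw : SmoothFunNear E w x)
    (v : TangentSpace 𝓘(ℝ, E) x) :
    d% (gradInner E u w) x v = hess u x v (grad w x) + hess w x v (grad u x) := by
  have h := mvfderiv_innerField_apply hu.grad hw.grad v
  rw [real_inner_comm (leviCivita (grad w) x v)] at h
  exact h

theorem SmoothFunNear.gradInner (hu : SmoothFunNear E u x) (hw : SmoothFunNear E w x) :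
    SmoothFunNear E (gradInner E u w) x :=
  hu.grad.innerField hw.grad

theorem SmoothFunNear.laplacian (hu : SmoothFunNear E u x) :
    SmoothFunNear E (laplacian E u) x :=
  (smoothEndNear_leviCivita hu.grad).trace

variable {ι : Type*} [Fintype ι] {e : OrthonormalBasis ι ℝ (TangentSpace 𝓘(ℝ, E) x)}
  {F : ι → Π y : M, TangentSpace 𝓘(ℝ, E) y}

theorem IsNormalFrameAt.mvfderiv_trace (hF : IsNormalFrameAt e F)
    {A : Π y : M, TangentSpace 𝓘(ℝ, E) y →ₗ[ℝ] TangentSpace 𝓘(ℝ, E) y} (hA : SmoothEndNear A x)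
    (v : TangentSpace 𝓘(ℝ, E) x) :
    d% (fun y ↦ LinearMap.trace ℝ _ (A y)) x v
      = ∑ i, inner ℝ (leviCivita (fun y ↦ A y (F i y)) x v) (e i) :=
  hA.mvfderiv_trace_eq_sum e hF.smooth hF.eq_basis hF.leviCivita_eq_zero v

theorem IsNormalFrameAt.mvfderiv_innerField_right (hF : IsNormalFrameAt e F)
    (hY : SmoothNear Y x) (i : ι) (v : TangentSpace 𝓘(ℝ, E) x) :
    d% (innerField Y (F i)) x v = inner ℝ (leviCivita Y x v) (e i) := by
  rw [mvfderiv_innerField_apply hY (hF.smooth i), hF.leviCivita_eq_zero, hF.eq_basis]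
  simp

theorem IsNormalFrameAt.mvfderiv_ricci (hF : IsNormalFrameAt e F) (hZ : SmoothNear Z x)
    (hW : SmoothNear W x) (v : TangentSpace 𝓘(ℝ, E) x) :
    d% (fun y ↦ ricci y (Z y) (W y)) x v
      = ∑ k, inner ℝ (leviCivita (riemann (F k) Z W) x v) (e k) := by
  simp only [ricci_eq_trace]
  rw [hF.mvfderiv_trace (smoothEndNear_curvatureEnd hZ hW)]
  refine Finset.sum_congr rfl fun k _ ↦ ?_
  rw [leviCivita_congr ((hF.smooth k).riemann hZ hW)]
  filter_upwards [(hF.smooth k).eventually, hZ.eventually, hW.eventually] with y h1 h2 h3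
  exact curvatureEnd_apply h1 h2 h3

/-- The contracted Bianchi identity `2 div Ric = d R`: the second Bianchi identity traced twice. -/
theorem IsNormalFrameAt.contracted_bianchi (hF : IsNormalFrameAt e F) (hZ : SmoothNear Z x)
    (hZ0 : leviCivita Z x = 0) :
    2 * ∑ i, d% (fun y ↦ ricci y (Z y) (F i y)) x (e i)
      = ∑ j, d% (fun y ↦ ricci y (F j y) (F j y)) x (Z x) := by
  have hs : ∀ {X Y : Π x : M, TangentSpace 𝓘(ℝ, E) x}, SmoothNear X x → SmoothNear Y x →
      ∀ (i k : ι) (v : TangentSpace 𝓘(ℝ, E) x),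
      inner ℝ (leviCivita (riemann X Y (F i)) x v) (e k)
        = -inner ℝ (leviCivita (riemann Y X (F i)) x v) (e k) := by
    intro X Y hX hY i k v
    have : riemann X Y (F i) = -riemann Y X (F i) := by
      ext y
      exact riemann_swap
    rw [this, leviCivita_neg (hY.riemann hX (hF.smooth i))]
    simp
  have ha : ∀ {X Y : Π x : M, TangentSpace 𝓘(ℝ, E) x}, SmoothNear X x → SmoothNear Y x →
      ∀ (i k : ι) (v : TangentSpace 𝓘(ℝ, E) x),
      inner ℝ (leviCivita (riemann X Y (F i)) x v) (e k)
        = -inner ℝ (leviCivita (riemann X Y (F k)) x v) (e i) := by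
    intro X Y hX hY i k v
    have h1 : ∀ᶠ y in 𝓝 x, innerField (riemann X Y (F i)) (F k) y
        = (-innerField (riemann X Y (F k)) (F i)) y := by
      filter_upwards [hX.eventually, hY.eventually, (hF.smooth i).eventually,
        (hF.smooth k).eventually] with y h1 h2 h3 h4
      simp only [innerField, Pi.neg_apply]
      rw [inner_riemann_antisymm h1 h2 h3 h4, real_inner_comm]
    rw [← hF.mvfderiv_innerField_right (hX.riemann hY (hF.smooth i)),
      ← hF.mvfderiv_innerField_right (hX.riemann hY (hF.smooth k)), mvfderiv_congr h1,
      mvfderiv_neg]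
    simp
  have hb : ∀ j k : ι, inner ℝ (leviCivita (riemann (F k) (F j) (F j)) x (Z x)) (e k)
      = inner ℝ (leviCivita (riemann (F j) Z (F k)) x (e k)) (e j)
        + inner ℝ (leviCivita (riemann (F k) Z (F j)) x (e j)) (e k) := by
    intro j k
    have h := second_bianchi hZ (hF.smooth k) (hF.smooth j) (hF.smooth j) hZ0
      (hF.leviCivita_eq_zero k) (hF.leviCivita_eq_zero j) (hF.leviCivita_eq_zero j)
    simp only [nabla, hF.eq_basis] at h
    have h' := congrArg (fun t ↦ inner ℝ t (e k)) h
    simp only [inner_add_left, inner_zero_left] at h'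
    rw [ha (hF.smooth j) hZ j k, hs hZ (hF.smooth k) j k] at h'
    linarith
  simp only [hF.mvfderiv_ricci hZ (hF.smooth _), hF.mvfderiv_ricci (hF.smooth _) (hF.smooth _),
    hb, Finset.sum_add_distrib]
  rw [Finset.sum_comm (f := fun j k ↦
    inner ℝ (leviCivita (riemann (F j) Z (F k)) x (e k)) (e j)), two_mul]

/-- The divergence of the Hessian (a contracted Ricci identity): `div ∇²u = d Δu + Ric(∇u, ·)`. -/
theorem IsNormalFrameAt.divergence_hess (hF : IsNormalFrameAt e F) (hu : SmoothFunNear E u x)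
    (hZ : SmoothNear Z x) (hZ0 : leviCivita Z x = 0) :
    ∑ i, d% (fun y ↦ hess u y (Z y) (F i y)) x (e i)
      = d% (laplacian E u) x (Z x) + ricci x (Z x) (grad u x) := by
  have hg := hu.grad
  have h1 : ∀ i, d% (fun y ↦ hess u y (Z y) (F i y)) x (e i)
      = inner ℝ (leviCivita (nabla Z (grad u)) x (e i)) (e i) := fun i ↦
    hF.mvfderiv_innerField_right (hZ.leviCivita hg) i (e i)
  have h2 : d% (laplacian E u) x (Z x)
      = ∑ i, inner ℝ (leviCivita (nabla (F i) (grad u)) x (Z x)) (e i) :=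
    hF.mvfderiv_trace (smoothEndNear_leviCivita hg) (Z x)
  have h3 : ricci x (Z x) (grad u x) = ∑ i, inner ℝ (riemann (F i) Z (grad u) x) (e i) := by
    rw [ricci_eq_trace, LinearMap.trace_eq_sum_inner _ e]
    refine Finset.sum_congr rfl fun i _ ↦ ?_
    rw [← hF.eq_basis, curvatureEnd_apply (hF.smooth i) hZ hg, real_inner_comm]
  rw [h2, h3, ← Finset.sum_add_distrib]
  refine Finset.sum_congr rfl fun i _ ↦ ?_
  rw [h1, ← inner_add_left, riemann,
    mlieBracket_eq_zero (hF.smooth i) hZ (hF.leviCivita_eq_zero i) hZ0, hF.eq_basis]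
  simp

end NormalFrame

/-! ### The divergence of the Ricci-Hessian equation -/

namespace IsRicciHessianType

variable {m : ℕ} {φ f lam : M → ℝ}

theorem smoothFunNear_ratio (h : IsRicciHessianType E m φ f lam) :
    SmoothFunNear E (fun y ↦ m / f y) x := by
  simp only [div_eq_mul_inv]
  exact (smoothFunNear_const _).mul
    ((smoothFunNear_of_contMDiff h.smooth_warping).inv (h.warping_pos x).ne')

theorem mvfderiv_ratio (h : IsRicciHessianType E m φ f lam) (v : TangentSpace 𝓘(ℝ, E) x) :
    d% (fun y ↦ m / f y) x v = -(m / f x ^ 2) * d% f x v := by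
  have hf := h.warping_pos x
  have h1 : (fun y ↦ m / f y) * f = fun _ ↦ (m : ℝ) := by
    ext y
    exact div_mul_cancel₀ _ (h.warping_pos y).ne'
  have h2 := mvfderiv_mul h.smoothFunNear_ratio.mdiffAt
    (smoothFunNear_of_contMDiff (x := x) h.smooth_warping).mdiffAt
  rw [h1, mvfderiv_const] at h2
  have h3 := DFunLike.congr_fun h2 v
  simp only [zero_apply, add_apply, FunLike.coe_smul, Pi.smul_apply, smul_eq_mul] at h3
  field_simp at h3 ⊢
  linear_combination -h3

/-- The differential of the scalar curvature `n λ + (m / f) Δf - Δφ`, in a normal frame. -/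
theorem sum_mvfderiv_ricci (h : IsRicciHessianType E m φ f lam) {ι : Type*} [Fintype ι]
    {e : OrthonormalBasis ι ℝ (TangentSpace 𝓘(ℝ, E) x)} {F : ι → Π y : M, TangentSpace 𝓘(ℝ, E) y}
    (hF : IsNormalFrameAt e F) (v : TangentSpace 𝓘(ℝ, E) x) :
    ∑ j, d% (fun y ↦ ricci y (F j y) (F j y)) x v
      = finrank ℝ E * d% lam x v + (m / f x) * d% (laplacian E f) x v
        - (m / f x ^ 2) * laplacian E f x * d% f x v - d% (laplacian E φ) x v := by
  have hφ := smoothFunNear_of_contMDiff (x := x) h.smooth_potential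
  have hf := smoothFunNear_of_contMDiff (x := x) h.smooth_warping
  have hl := smoothFunNear_of_contMDiff (x := x) h.smooth_lam
  have hq := h.smoothFunNear_ratio (x := x)
  -- the Ricci endomorphism
  let A : Π y : M, TangentSpace 𝓘(ℝ, E) y →ₗ[ℝ] TangentSpace 𝓘(ℝ, E) y := fun y ↦
    lam y • LinearMap.id + (m / f y) • (leviCivita (grad f) y).toLinearMap
      - (leviCivita (grad φ) y).toLinearMap
  have hA : SmoothEndNear A x := fun V hV ↦
    ((SmoothNear.smul hl hV).add (.smul hq (hV.leviCivita hf.grad))).sub (hV.leviCivita hφ.grad)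
  have hAr : ∀ y v w, inner ℝ (A y v) w = ricci y v w := by
    intro y v w
    have h1 := h.equation y v w
    simp only [hess] at h1
    simp only [A, LinearMap.sub_apply, LinearMap.add_apply, LinearMap.smul_apply,
      LinearMap.id_apply, inner_sub_left, inner_add_left, real_inner_smul_left,
      ContinuousLinearMap.coe_coe]
    linarith
  have htr : (fun y ↦ LinearMap.trace ℝ _ (A y))
      = (fun _ ↦ (finrank ℝ E : ℝ)) * lam + (fun y ↦ m / f y) * laplacian E f
        - laplacian E φ := by
    ext y
    have : LinearMap.trace ℝ (TangentSpace 𝓘(ℝ, E) y) LinearMap.id = finrank ℝ E :=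
      LinearMap.trace_id ℝ _
    simp only [A, map_sub, map_add, map_smul, this]
    simp [laplacian, mul_comm]
  have hn := smoothFunNear_const (E := E) (x := x) (finrank ℝ E)
  have h1 : d% (fun y ↦ LinearMap.trace ℝ _ (A y)) x v
      = ∑ j, d% (fun y ↦ ricci y (F j y) (F j y)) x v := by
    rw [hF.mvfderiv_trace hA]
    refine Finset.sum_congr rfl fun j _ ↦ ?_
    rw [← hF.mvfderiv_innerField_right (hA _ (hF.smooth j))]
    have : innerField (fun y ↦ A y (F j y)) (F j) = fun y ↦ ricci y (F j y) (F j y) := by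
      ext y
      exact hAr y _ _
    rw [this]
  rw [← h1, htr, mvfderiv_sub ((hn.mul hl).add (hq.mul hf.laplacian)).mdiffAt hφ.laplacian.mdiffAt,
    mvfderiv_add (hn.mul hl).mdiffAt (hq.mul hf.laplacian).mdiffAt,
    mvfderiv_mul hn.mdiffAt hl.mdiffAt, mvfderiv_mul hq.mdiffAt hf.laplacian.mdiffAt,
    mvfderiv_const]
  simp only [sub_apply, add_apply, FunLike.coe_smul, Pi.smul_apply, smul_eq_mul, zero_apply,
    h.mvfderiv_ratio]
  ring

/-- Twice the divergence of the Ricci-Hessian equation minus the differential of its trace,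
multiplied by `f ^ 2`. -/
theorem divergence_identity (h : IsRicciHessianType E m φ f lam)
    (v : TangentSpace 𝓘(ℝ, E) x) :
    f x ^ 2 * ((finrank ℝ E - 2) * d% lam x v + d% (laplacian E φ) x v
        + 2 * lam x * d% φ x v - d% (gradInner E φ φ) x v)
      + 2 * m * f x * d% (gradInner E φ f) x v
      = m * (f x * d% (laplacian E f) x v + (laplacian E f x + 2 * f x * lam x) * d% f x v
        + (m - 1) * d% (gradInner E f f) x v) := by
  have hφ := smoothFunNear_of_contMDiff (x := x) h.smooth_potential
  have hf := smoothFunNear_of_contMDiff (x := x) h.smooth_warping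
  have hl := smoothFunNear_of_contMDiff (x := x) h.smooth_lam
  have hq := h.smoothFunNear_ratio (x := x)
  have hf0 := h.warping_pos x
  let e := stdOrthonormalBasis ℝ (TangentSpace 𝓘(ℝ, E) x)
  obtain ⟨F, hF⟩ := exists_isNormalFrameAt e
  obtain ⟨Z, hZ, rfl, hZ0⟩ := exists_parallel v
  have hess_smooth : ∀ {u : M → ℝ}, SmoothFunNear E u x → ∀ i,
      SmoothFunNear E (fun y ↦ hess u y (Z y) (F i y)) x := fun hu i ↦
    SmoothNear.innerField (hZ.leviCivita hu.grad) (hF.smooth i)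
  have h1 : ∀ i, d% (fun y ↦ ricci y (Z y) (F i y)) x (e i)
      = inner ℝ (Z x) (e i) * d% lam x (e i)
        + (m / f x) * d% (fun y ↦ hess f y (Z y) (F i y)) x (e i)
        - (m / f x ^ 2) * (inner ℝ (leviCivita (grad f) x (Z x)) (e i)
          * inner ℝ (e i) (grad f x))
        - d% (fun y ↦ hess φ y (Z y) (F i y)) x (e i) := by
    intro i
    have hi := hZ.innerField (hF.smooth i)
    have e1 : (fun y ↦ ricci y (Z y) (F i y)) = lam * innerField Z (F i)
        + (fun y ↦ m / f y) * (fun y ↦ hess f y (Z y) (F i y))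
        - fun y ↦ hess φ y (Z y) (F i y) := by
      ext y
      exact eq_sub_of_add_eq (h.equation y _ _)
    have e2 : inner ℝ (e i) (grad f x) = d% f x (e i) := by
      rw [real_inner_comm, inner_grad]
    have e3 : innerField Z (F i) x = inner ℝ (Z x) (e i) := by
      rw [innerField, hF.eq_basis]
    have e4 : hess f x (Z x) (F i x) = inner ℝ (leviCivita (grad f) x (Z x)) (e i) := by
      rw [hess, hF.eq_basis]
    rw [e1, mvfderiv_sub ((hl.mul hi).add (hq.mul (hess_smooth hf i))).mdiffAt
      (hess_smooth hφ i).mdiffAt,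
      mvfderiv_add (hl.mul hi).mdiffAt (hq.mul (hess_smooth hf i)).mdiffAt,
      mvfderiv_mul hl.mdiffAt hi.mdiffAt, mvfderiv_mul hq.mdiffAt (hess_smooth hf i).mdiffAt]
    simp only [sub_apply, add_apply, FunLike.coe_smul, Pi.smul_apply, smul_eq_mul,
      h.mvfderiv_ratio, hF.mvfderiv_innerField_right hZ, hZ0, e2, e3, e4, zero_apply,
      inner_zero_left]
    ring
  have h2 : ∑ i, inner ℝ (Z x) (e i) * d% lam x (e i) = d% lam x (Z x) := by
    have h3 : ∀ i, d% lam x (e i) = inner ℝ (e i) (grad lam x) := fun i ↦ by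
      rw [real_inner_comm, inner_grad]
    simp only [h3]
    rw [e.sum_inner_mul_inner, real_inner_comm, inner_grad]
  have hB := hF.contracted_bianchi hZ hZ0
  rw [h.sum_mvfderiv_ricci hF, Finset.sum_congr rfl fun i _ ↦ h1 i, Finset.sum_sub_distrib,
    Finset.sum_sub_distrib, Finset.sum_add_distrib, ← Finset.mul_sum, ← Finset.mul_sum, h2,
    e.sum_inner_mul_inner, hF.divergence_hess hf hZ hZ0, hF.divergence_hess hφ hZ hZ0] at hB
  have hrf := h.equation x (Z x) (grad f x)
  have hrφ := h.equation x (Z x) (grad φ x)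
  rw [real_inner_comm, inner_grad] at hrf hrφ
  rw [mvfderiv_gradInner hφ hf, mvfderiv_gradInner hφ hφ, mvfderiv_gradInner hf hf]
  change 2 * (_ + _ - (m / f x ^ 2) * hess f x (Z x) (grad f x) - _) = _ at hB
  have hrf' := eq_sub_of_add_eq hrf
  have hrφ' := eq_sub_of_add_eq hrφ
  rw [hrf', hrφ'] at hB
  field_simp at hB
  linear_combination -hB

end IsRicciHessianType

/-- The exterior derivative of `IsRicciHessianType.divergence_identity`, divided by `2 f`. -/
theorem IsRicciHessianType.wedge_identity {m : ℕ} {φ f lam : M → ℝ}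
    (h : IsRicciHessianType E m φ f lam) {x : M} (v w : TangentSpace 𝓘(ℝ, E) x) :
    f x * (d% φ x v * d% lam x w - d% φ x w * d% lam x v) =
      d% f x v * (((finrank ℝ E : ℝ) + m - 2) * d% lam x w + m / f x * d% (gradInner E φ f) x w
          - d% (gradInner E φ φ) x w + 2 * lam x * d% φ x w + d% (laplacian E φ) x w)
        - d% f x w * (((finrank ℝ E : ℝ) + m - 2) * d% lam x v
          + m / f x * d% (gradInner E φ f) x v - d% (gradInner E φ φ) x v
          + 2 * lam x * d% φ x v + d% (laplacian E φ) x v) := by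
  have hφ := fun x ↦ smoothFunNear_of_contMDiff (x := x) h.smooth_potential
  have hf := fun x ↦ smoothFunNear_of_contMDiff (x := x) h.smooth_warping
  have hl := fun x ↦ smoothFunNear_of_contMDiff (x := x) h.smooth_lam
  have hf0 := h.warping_pos x
  let c : ℝ → M → ℝ := fun r _ ↦ r
  have hc : ∀ r x, SmoothFunNear E (c r) x := fun r x ↦ smoothFunNear_const r
  have hc0 : ∀ r x, d% (c r) x = 0 := fun r x ↦ mvfderiv_const r
  -- `divergence_identity` reads `∑ a i • d (b i) = 0`.  The last coefficient is constant, so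
  -- `|∇f|²` drops out of `∑ d (a i) ∧ d (b i) = 0`.
  let a : Fin 8 → M → ℝ := ![c (finrank ℝ E - 2) * (f * f), f * f, c 2 * (f * f * lam),
    c (-1) * (f * f), c (2 * m) * f, c (-m) * f, c (-m) * (laplacian E f + c 2 * (f * lam)),
    c (-(m * (m - 1)))]
  let b : Fin 8 → M → ℝ := ![lam, laplacian E φ, φ, gradInner E φ φ, gradInner E φ f,
    laplacian E f, f, gradInner E f f]
  have hff := (hf x).mul (hf x)
  have hffl := hff.mul (hl x)
  have hfl := (hf x).mul (hl x)
  have hL := (hf x).laplacian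
  have hLl := hL.add ((hc 2 x).mul hfl)
  have ha : ∀ i, SmoothFunNear E (a i) x := by
    intro i
    fin_cases i
    exacts [(hc _ x).mul hff, hff, (hc _ x).mul hffl, (hc _ x).mul hff, (hc _ x).mul (hf x),
      (hc _ x).mul (hf x), (hc _ x).mul hLl, hc _ x]
  have hb : ∀ i, SmoothFunNear E (b i) x := by
    intro i
    fin_cases i
    exacts [hl x, (hφ x).laplacian, hφ x, (hφ x).gradInner (hφ x), (hφ x).gradInner (hf x), hL,
      hf x, (hf x).gradInner (hf x)]
  have key := sum_wedge_eq_zero_of_sum_smul_eq_zero ha hb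
    (Eventually.of_forall fun y v ↦ by
      have := h.divergence_identity v
      simp only [Fin.sum_univ_eight, a, b, c, Matrix.cons_val, Pi.mul_apply, Pi.add_apply]
      linear_combination this) v w
  simp only [Fin.sum_univ_eight, a, b, Matrix.cons_val] at key
  rw [mvfderiv_mul (hc _ x).mdiffAt hff.mdiffAt, mvfderiv_mul (hc _ x).mdiffAt hffl.mdiffAt,
    mvfderiv_mul (hc _ x).mdiffAt hff.mdiffAt, mvfderiv_mul (hc _ x).mdiffAt (hf x).mdiffAt,
    mvfderiv_mul (hc _ x).mdiffAt (hf x).mdiffAt, mvfderiv_mul (hc _ x).mdiffAt hLl.mdiffAt,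
    mvfderiv_mul hff.mdiffAt (hl x).mdiffAt, mvfderiv_mul (hf x).mdiffAt (hf x).mdiffAt,
    mvfderiv_add hL.mdiffAt ((hc 2 x).mul hfl).mdiffAt,
    mvfderiv_mul (hc _ x).mdiffAt hfl.mdiffAt, mvfderiv_mul (hf x).mdiffAt (hl x).mdiffAt] at key
  simp only [hc0, add_apply, FunLike.coe_smul, Pi.smul_apply, Pi.mul_apply, Pi.add_apply,
    smul_eq_mul, zero_apply, smul_zero, c] at key
  field_simp
  linear_combination (-1 / 2) * key

/-! ### Wedge products of two and three linear forms -/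

theorem wedge_two_apply {V : Type*} [AddCommGroup V] [Module ℝ V] (α β : V →ₗ[ℝ] ℝ)
    (v : Fin 2 → V) : wedge ![α, β] v = α (v 0) * β (v 1) - α (v 1) * β (v 0) := by
  change Matrix.det (Matrix.of fun i j ↦ ![α, β] j (v i)) = _
  simp only [Matrix.det_fin_two, Matrix.of_apply, Matrix.cons_val]
  ring

theorem wedge_three_apply {V : Type*} [AddCommGroup V] [Module ℝ V] (α β γ : V →ₗ[ℝ] ℝ)
    (v : Fin 3 → V) : wedge ![α, β, γ] v =
      α (v 0) * (β (v 1) * γ (v 2) - β (v 2) * γ (v 1))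
        - α (v 1) * (β (v 0) * γ (v 2) - β (v 2) * γ (v 0))
        + α (v 2) * (β (v 0) * γ (v 1) - β (v 1) * γ (v 0)) := by
  change Matrix.det (Matrix.of fun i j ↦ ![α, β, γ] j (v i)) = _
  simp only [Matrix.det_fin_three, Matrix.of_apply, Matrix.cons_val]
  ring

end RicciHessian

end

open RicciHessian

theorem proposition1p1 {n m : ℕ} {M : Type*} [TopologicalSpace M]
    [ChartedSpace (EuclideanSpace ℝ (Fin n)) M] [IsManifold (𝓡 n) ∞ M]
    [RiemannianBundle (fun x : M ↦ TangentSpace (𝓡 n) x)]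
    [IsContMDiffRiemannianBundle (𝓡 n) ∞ (EuclideanSpace ℝ (Fin n))
      (fun x : M ↦ TangentSpace (𝓡 n) x)]
    {φ f lam : M → ℝ} (h : IsRicciHessianType (EuclideanSpace ℝ (Fin n)) m φ f lam) :
    (∀ x : M,
      f x • wedge ![(mvfderiv (𝓡 n) φ x).toLinearMap, (mvfderiv (𝓡 n) lam x).toLinearMap] =
        wedge ![(mvfderiv (𝓡 n) f x).toLinearMap,
          (((n : ℝ) + m - 2) • mvfderiv (𝓡 n) lam x
            + (m / f x) • mvfderiv (𝓡 n) (gradInner (EuclideanSpace ℝ (Fin n)) φ f) x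
            - mvfderiv (𝓡 n) (gradInner (EuclideanSpace ℝ (Fin n)) φ φ) x
            + (2 * lam x) • mvfderiv (𝓡 n) φ x
            + mvfderiv (𝓡 n) (laplacian (EuclideanSpace ℝ (Fin n)) φ) x).toLinearMap]) ∧
    (∀ x : M,
      wedge ![(mvfderiv (𝓡 n) f x).toLinearMap, (mvfderiv (𝓡 n) φ x).toLinearMap,
        (mvfderiv (𝓡 n) lam x).toLinearMap] = 0) := by
  refine ⟨fun x ↦ ?_, fun x ↦ ?_⟩
  · ext v
    have key := h.wedge_identity (v 0) (v 1)
    rw [finrank_euclideanSpace_fin] at key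
    rw [AlternatingMap.smul_apply, wedge_two_apply, wedge_two_apply]
    exact key
  · ext v
    have h01 := h.wedge_identity (v 0) (v 1)
    have h02 := h.wedge_identity (v 0) (v 2)
    have h12 := h.wedge_identity (v 1) (v 2)
    rw [wedge_three_apply]
    apply mul_left_cancel₀ (h.warping_pos x).ne'
    simp only [ContinuousLinearMap.coe_coe, AlternatingMap.zero_apply, mul_zero]
    -- expansion of `df ∧ (dφ ∧ dλ)` along `df`
    linear_combination mvfderiv (𝓡 n) f x (v 0) * h12 - mvfderiv (𝓡 n) f x (v 1) * h02
      + mvfderiv (𝓡 n) f x (v 2) * h01
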